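/- **Theorem.** Let $h_n=\sum_{m=1}^{n}\frac1{2m-1}$ and $t_n(1)=\sum_{m=0}^{n}\frac1{m+\frac12}$. Let $\psi^{(0)}=\Gamma'/\Gamma$ be the digamma function, $\psi^{(1)}$ its derivative, and $H_z=\psi^{(0)}(z+1)+\gamma$ for real $z>-1$, where $\gamma$ is Euler's constant. Let $\beta(s)=\sum_{n\ge1}\frac{(-1)^{n+1}}{(2n-1)^s}$, let $G=\beta(2)$ be Catalan's constant, and let $W(3)=\Im \mathrm{Li}_3\left(\frac{1+i}{2}\right)$, where $\mathrm{Li}_3(z)=\sum_{n\ge1}\frac{z^n}{n^3}$. Then for every integer $k\ge0$ the two double series below converge absolutely, and \begin{align*} &\sum_{n=1}^{\infty}\sum_{j=0}^{\infty}\frac{(-1)^{n+j}h_{n}}{n(2j+2n+2k+1)^{2}} =\sum_{n=0}^{\infty}\sum_{j=0}^{\infty}\frac{(-1)^{n+j+1}t_{n}(1)}{2(n+1)(2n+2j+2k+3)^{2}}\\ &=\sum_{j=1}^{k}\frac{(-1)^{j+1}}{2k-2j+1}\Bigg\{-\frac{\pi^{2}}{16} +\frac{k-j}{2k-2j+1}\Bigg(\frac{\pi^{2}}{8}-(-1)^{k-j}2G+\frac{(-1)^{k-j}}{2}\pi\ln2\\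 &\qquad-\sum_{i=1}^{k-j}(-1)^{i+1}\frac{\pi+H_{\frac{2k-2j-2i-1}{4}}-H_{\frac{2k-2j-2i+1}{4}}}{2k+2-2j-2i}\Bigg)\\ &\quad-2\Bigg[\sum_{i=1}^{k-j}\frac{(-1)^{i+1}}{64(k+1-j-i)^{2}}\Bigg(-4\pi+4\psi^{(0)}\Big(\tfrac{2k+5-2j-2i}{4}\Big)-4\psi^{(0)}\Big(\tfrac{2k+3-2j-2i}{4}\Big)\\ &\qquad-2(k+1-j-i)\Big(\psi^{(1)}\Big(\tfrac{2k+5-2j-2i}{4}\Big)-\psi^{(1)}\Big(\tfrac{2k+3-2j-2i}{4}\Big)\Big)\Bigg)\\ &\qquad+\frac{(-1)^{k-j}}{96}\big(3\pi^{3}+6\pi(\ln2)^2-192W(3)\big)\Bigg]\\ &\quad+2\Bigg[\sum_{i=1}^{k-j}(-1)^{i+1}\frac{\pi+H_{\frac{2k-1-2j-2i}{4}}-H_{\frac{2k+1-2j-2i}{4}}}{8(k+1-j-i)}+(-1)^{k-j}\frac{4G-\pi\ln2}{8}\Bigg]\Bigg\}\\ &\quad+\frac{(-1)^{k}}{48}\left(-3G\pi^{2}+24\beta(4)\right).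 \end{align*} -/

import Mathlib

namespace ArctanLogSums

noncomputable section

/-- The odd harmonic number `h_n = ∑_{k=1}^n 1/(2k-1)`. -/
def oddHarmonic (n : ℕ) : ℝ := ∑ k ∈ Finset.Icc 1 n, 1 / (2 * (k : ℝ) - 1)

/-- The Milgram constant `t_k(n)`, written `milgram n k`: the `n`-fold nested sum
`∑_{m_n=0}^{k} 1/(m_n + n/2) ∑_{m_{n-1}=0}^{m_n} 1/(m_{n-1} + (n-1)/2) ⋯ ∑_{m_1=0}^{m_2} 1/(m_1 + 1/2)`,
with the empty nested sum equal to `1`. -/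
def milgram : ℕ → ℕ → ℝ
  | 0, _ => 1
  | n + 1, k => ∑ m ∈ Finset.range (k + 1), 1 / ((m : ℝ) + ((n : ℝ) + 1) / 2) * milgram n m

/-- The polygamma function `ψ^{(n)}` at a positive real `x`: the `n`-th derivative of the digamma
function (which takes real values there). -/
def polygamma (n : ℕ) (x : ℝ) : ℝ := (iteratedDeriv n Complex.digamma (x : ℂ)).re

/-- The harmonic number `H_z = ψ(z+1) + γ` of a real index `z > -1`. -/
def harmonicNumber (z : ℝ) : ℝ := polygamma 0 (z + 1) + Real.eulerMascheroniConstant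

/-- The polylogarithm `Li_s(z) = ∑_{n ≥ 1} z^n / n^s` for `|z| ≤ 1`, `s ≥ 2`. -/
def polylog (s : ℕ) (z : ℂ) : ℂ := ∑' n : ℕ, z ^ (n + 1) / ((n : ℂ) + 1) ^ s

/-- `W(3) = Im Li_3((1+i)/2)`. -/
def W3 : ℝ := (polylog 3 ((1 + Complex.I) / 2)).im

/-- The Dirichlet beta value `β(s) = ∑_{n ≥ 0} (-1)^n / (2n+1)^s` at an integer `s ≥ 2`
(where the series converges absolutely). -/
def dirichletBeta (s : ℕ) : ℝ := ∑' n : ℕ, (-1 : ℝ) ^ n / (2 * (n : ℝ) + 1) ^ s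

/-- Catalan's constant `G = β(2)`. -/
def catalanG : ℝ := dirichletBeta 2

/-- The general term of the first double series, at outer index `n ≥ 1` and inner index `j ≥ 0`. -/
def hTerm (k n j : ℕ) : ℝ :=
  (-1) ^ (n + j) * oddHarmonic n / ((n : ℝ) * (2 * (j : ℝ) + 2 * n + 2 * k + 1) ^ 2)

/-- The general term of the second double series, at outer index `n ≥ 0` and inner index
`j ≥ 0`. -/
def tTerm (k n j : ℕ) : ℝ :=
  (-1) ^ (n + j + 1) * milgram 1 n /
    (2 * ((n : ℝ) + 1) * (2 * (n : ℝ) + 2 * j + 2 * k + 3) ^ 2)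

end

end ArctanLogSums

open ArctanLogSums

/-! ### Polylogarithms and their continuation across the unit circle away from 1. -/

namespace ArctanLogSums
open Complex Metric Set Filter Topology

/-! Both series equal the integral over `[0, 1]` of `x^(2k) log x arctan² x / (1 + x²)`, named
`arctanSqLogMoment k`. The Cauchy square of the arctangent series is `arctan² x = ∑ (-1)^n h_{n+1} /
(n+1) x^(2n+2)`; multiplying by the geometric series of `1 / (1 + x²)` and integrating `x^(2N) log
x` to `-1 / (2N+1)²` gives the double series termwise (`hasSum_hTerm`). The second series has the
same terms because `t_n(1) = 2 h_{n+1}`.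

Since `x^(m+2) + x^m = x^m (1 + x²)`, adding the integrals for `k` and `k + 1` clears the
denominator. Integration by parts then leaves the moments `arctanMoment` and `arctanLogMoment`, with
`arctan` to the first power. The same trick applied to these leaves moments of `1 / (1 + x²)`, which
are differences of `ψ` and `ψ'` at quarter-integers (`polygamma_zero_sub`, `polygamma_one_sub`).
Unrolling the recurrences by `eq_alternating_sum` produces the nested finite sums.

There remain three initial values, which under `x = tan t` become integrals over `[0, π/4]`. Those
of `t² log tan t` and `t tan t` follow from polylogarithms on the unit circle, whose successive
derivatives in the angle lower the order. That of `t tan t log tan t`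
(`integral_log_tan_mul_mul_tan`) needs an explicit primitive of `log² (1 - z) / (2z)` built from
trilogarithms, evaluated along two paths ending at `-i`; there `z / (z - 1) = (1 + i) / 2`, the
source of `W(3)`. -/

lemma summable_one_div_succ_pow {s : ℕ} (hs : 2 ≤ s) :
    Summable fun n : ℕ => 1 / ((n : ℝ) + 1) ^ s := by
  have := (summable_nat_add_iff 1).2 (Real.summable_one_div_nat_pow.2 (by lia : 1 < s))
  simpa using this

lemma norm_polylog_term_le (s n : ℕ) {z : ℂ} (hz : ‖z‖ ≤ 1) :
    ‖z ^ (n + 1) / ((n : ℂ) + 1) ^ s‖ ≤ 1 / ((n : ℝ) + 1) ^ s := by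
  have h : ‖(n : ℂ) + 1‖ = (n : ℝ) + 1 := by
    have := Complex.norm_natCast (n + 1)
    push_cast at this
    exact this
  rw [norm_div, norm_pow, norm_pow, h]
  gcongr
  exact pow_le_one₀ (norm_nonneg _) hz

lemma summable_polylog {s : ℕ} (hs : 2 ≤ s) {z : ℂ} (hz : ‖z‖ ≤ 1) :
    Summable fun n : ℕ => z ^ (n + 1) / ((n : ℂ) + 1) ^ s :=
  .of_norm_bounded (summable_one_div_succ_pow hs) fun n => norm_polylog_term_le s n hz

lemma continuousOn_polylog {s : ℕ} (hs : 2 ≤ s) :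
    ContinuousOn (polylog s) (closedBall 0 1) := by
  unfold polylog
  refine continuousOn_tsum (fun n => by fun_prop) (summable_one_div_succ_pow hs)
    fun n z hz => norm_polylog_term_le s n (by simpa using hz)

@[simp] lemma polylog_zero_right (s : ℕ) : polylog s 0 = 0 := by simp [polylog]

lemma polylog_one {z : ℂ} (hz : ‖z‖ < 1) : polylog 1 z = -log (1 - z) := by
  simpa [polylog] using (hasSum_taylorSeries_neg_log' hz).tsum_eq

/-- Termwise differentiation, dominated by a geometric series on a smaller disc. The derivative is
kept as a series so that the formula also covers `z = 0`, where `Li_s(z) / z` has a removable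
singularity. -/
lemma hasDerivAt_polylog_succ (s : ℕ) {z : ℂ} (hz : ‖z‖ < 1) :
    HasDerivAt (polylog (s + 1)) (∑' n : ℕ, z ^ n / ((n : ℂ) + 1) ^ s) z := by
  obtain ⟨r, hzr, hr⟩ := exists_between hz
  have hr0 : 0 ≤ r := (norm_nonneg z).trans hzr.le
  have hn (n : ℕ) : (n : ℂ) + 1 ≠ 0 := Nat.cast_add_one_ne_zero n
  unfold polylog
  refine hasDerivAt_tsum_of_isPreconnected (t := ball 0 r) (u := fun n : ℕ => r ^ n) (y₀ := 0)
    (g := fun (n : ℕ) (y : ℂ) => y ^ (n + 1) / ((n : ℂ) + 1) ^ (s + 1))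
    (g' := fun n y => y ^ n / ((n : ℂ) + 1) ^ s)
    (summable_geometric_of_lt_one hr0 hr) isOpen_ball
    (convex_ball 0 r).isPreconnected (fun n y _ => ?_) (fun n y hy => ?_)
    (mem_ball_self ((norm_nonneg z).trans_lt hzr)) (by simp) (by simpa using hzr)
  · refine ((hasDerivAt_pow (n + 1) y).div_const (((n : ℂ) + 1) ^ (s + 1))).congr_deriv ?_
    have := hn n
    simp only [add_tsub_cancel_right]
    push_cast
    field_simp
    ring
  · have h : ‖(n : ℂ) + 1‖ = (n : ℝ) + 1 := by
      have := Complex.norm_natCast (n + 1)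
      push_cast at this
      exact this
    have hy' : ‖y‖ < r := by simpa using hy
    rw [norm_div, norm_pow, norm_pow, h]
    refine (div_le_self (by positivity) (one_le_pow₀ (by simp))).trans ?_
    gcongr

lemma tsum_eq_dslope_polylog (s : ℕ) {z : ℂ} (hz : ‖z‖ < 1) :
    ∑' n : ℕ, z ^ n / ((n : ℂ) + 1) ^ s = dslope (polylog s) 0 z := by
  rcases eq_or_ne z 0 with rfl | h0
  · rw [dslope_same]
    have h1 : ∀ s : ℕ, ∑' n : ℕ, (0 : ℂ) ^ n / ((n : ℂ) + 1) ^ s = 1 := fun s => by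
      rw [tsum_eq_single 0 (by intro n hn; simp [hn])]
      simp
    rw [h1]
    cases s with
    | zero =>
      have : polylog 0 =ᶠ[𝓝 0] fun z => z * (1 - z)⁻¹ := by
        filter_upwards [ball_mem_nhds (0 : ℂ) one_pos] with z hz
        have hz : ‖z‖ < 1 := by simpa using hz
        simp only [polylog, pow_zero, div_one, pow_succ']
        rw [tsum_mul_left, tsum_geometric_of_norm_lt_one hz]
      rw [this.deriv_eq]
      have h := (hasDerivAt_id' (0 : ℂ)).fun_mul
        (((hasDerivAt_id' (0 : ℂ)).const_sub 1).fun_inv (by simp))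
      rw [h.deriv]
      simp
    | succ s => rw [(hasDerivAt_polylog_succ s (by simp)).deriv, h1]
  · rw [dslope_of_ne _ h0, slope_def_field]
    simp only [polylog_zero_right, sub_zero]
    rw [eq_div_iff h0, polylog, ← tsum_mul_right]
    congr 1 with n
    ring

/-- The disc `|z + 1/2| < 3/2`, which contains the closed unit disc without `1`. -/
abbrev bigDisc : Set ℂ := ball (-1 / 2) (3 / 2)

/-- `|z + 1/2|² = |z|² + Re z + 1/4`, which is below `9/4` as soon as `Re z < 1`. -/
lemma mem_bigDisc {z : ℂ} (hz : ‖z‖ ≤ 1) (h1 : z ≠ 1) : z ∈ bigDisc := by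
  have hsq : z.re * z.re + z.im * z.im ≤ 1 := by
    have := Complex.sq_norm z
    rw [Complex.normSq_apply] at this
    nlinarith [norm_nonneg z]
  have hre : z.re < 1 := by
    rcases lt_or_ge z.re 1 with h | h
    · exact h
    · exfalso
      apply h1
      apply Complex.ext
      · simp; nlinarith [mul_self_nonneg z.im]
      · simp; nlinarith [mul_self_nonneg z.im]
  rw [mem_ball, dist_eq_norm]
  have h2 := Complex.sq_norm (z - -1 / 2)
  rw [Complex.normSq_apply] at h2
  have h3 : (z - -1 / 2).re = z.re + 1 / 2 := by simp; norm_num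
  have h4 : (z - -1 / 2).im = z.im := by simp
  rw [h3, h4] at h2
  nlinarith [norm_nonneg (z - -1 / 2)]

lemma re_lt_one_of_mem_bigDisc {z : ℂ} (hz : z ∈ bigDisc) : z.re < 1 := by
  rw [mem_ball, dist_eq_norm] at hz
  have h := (abs_le.1 (Complex.abs_re_le_norm (z - -1 / 2))).2
  have h3 : (z - -1 / 2).re = z.re + 1 / 2 := by simp; norm_num
  linarith

lemma bigDisc_mem_nhds_zero : bigDisc ∈ 𝓝 (0 : ℂ) :=
  isOpen_ball.mem_nhds (mem_bigDisc (by simp) (by simp))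

lemma one_sub_mem_slitPlane {z : ℂ} (hz : z.re < 1) : 1 - z ∈ slitPlane := by
  left; simpa using hz

/-- Holomorphic functions on a disc have primitives. Differentiability of `f` sits inside the
existential so that `choose` can be used in a recursive definition before differentiability of the
previous stage has been proved. -/
lemma exists_primitive_dslope (f : ℂ → ℂ) : ∃ g : ℂ → ℂ, DifferentiableOn ℂ f bigDisc →
    g 0 = 0 ∧ ∀ z ∈ bigDisc, HasDerivAt g (dslope f 0 z) z := by
  by_cases hf : DifferentiableOn ℂ f bigDisc
  · obtain ⟨g, hg⟩ := ((differentiableOn_dslope bigDisc_mem_nhds_zero).2 hf).isExactOn_ball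
    refine ⟨fun z => g z - g 0, fun _ => ⟨by simp, fun z hz => (hg z hz).sub_const _⟩⟩
  · exact ⟨0, fun h => absurd h hf⟩

/-- The holomorphic extension of `Li_{n+1}` to `bigDisc`. -/
noncomputable def polylogExt : ℕ → ℂ → ℂ
  | 0 => fun z => -log (1 - z)
  | n + 1 => (exists_primitive_dslope (polylogExt n)).choose

lemma hasDerivAt_polylogExt_zero {z : ℂ} (hz : z.re < 1) :
    HasDerivAt (polylogExt 0) (1 / (1 - z)) z := by
  refine (((hasDerivAt_id' z).const_sub 1).clog (one_sub_mem_slitPlane hz)).neg.congr_deriv ?_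
  rw [neg_div, neg_neg]

lemma differentiableOn_polylogExt (n : ℕ) : DifferentiableOn ℂ (polylogExt n) bigDisc := by
  induction n with
  | zero => exact fun z hz => (hasDerivAt_polylogExt_zero
      (re_lt_one_of_mem_bigDisc hz)).differentiableAt.differentiableWithinAt
  | succ n ih =>
    exact fun z hz => (((exists_primitive_dslope (polylogExt n)).choose_spec ih).2 z
      hz).differentiableAt.differentiableWithinAt

lemma polylogExt_apply_zero (n : ℕ) : polylogExt n 0 = 0 := by
  cases n with
  | zero => simp [polylogExt]
  | succ n =>
    exact ((exists_primitive_dslope (polylogExt n)).choose_spec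
      (differentiableOn_polylogExt n)).1

lemma hasDerivAt_polylogExt_succ (n : ℕ) {z : ℂ} (hz : z ∈ bigDisc) :
    HasDerivAt (polylogExt (n + 1)) (dslope (polylogExt n) 0 z) z :=
  ((exists_primitive_dslope (polylogExt n)).choose_spec (differentiableOn_polylogExt n)).2 z hz

lemma dslope_polylogExt (n : ℕ) {z : ℂ} (hz : z ≠ 0) :
    dslope (polylogExt n) 0 z = polylogExt n z / z := by
  rw [dslope_of_ne _ hz, slope_def_field]
  simp [polylogExt_apply_zero]

/-- By induction both sides are primitives of the same function on the unit disc and vanish at 0. -/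
lemma polylogExt_eq_of_norm_lt_one (n : ℕ) {z : ℂ} (hz : ‖z‖ < 1) :
    polylogExt n z = polylog (n + 1) z := by
  induction n generalizing z with
  | zero => rw [zero_add, polylog_one hz]; rfl
  | succ n ih =>
    have hsub : ball (0 : ℂ) 1 ⊆ bigDisc := fun w hw => by
      have hw : ‖w‖ < 1 := by simpa using hw
      exact mem_bigDisc hw.le (by rintro rfl; simp at hw)
    have hds : ∀ w ∈ ball (0 : ℂ) 1,
        dslope (polylogExt n) 0 w = dslope (polylog (n + 1)) 0 w := fun w hw => by
      rcases eq_or_ne w 0 with rfl | h0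
      · rw [dslope_same, dslope_same]
        apply EventuallyEq.deriv_eq
        filter_upwards [ball_mem_nhds (0 : ℂ) one_pos] with v hv
        exact ih (by simpa using hv)
      · rw [dslope_of_ne _ h0, dslope_of_ne _ h0, slope_def_field, slope_def_field,
          ih (by simpa using hw), ih (by simp)]
    have hd1 : ∀ w ∈ ball (0 : ℂ) 1,
        HasDerivAt (polylogExt (n + 1)) (dslope (polylog (n + 1)) 0 w) w := fun w hw =>
      hds w hw ▸ hasDerivAt_polylogExt_succ n (hsub hw)
    have hd2 : ∀ w ∈ ball (0 : ℂ) 1,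
        HasDerivAt (polylog (n + 1 + 1)) (dslope (polylog (n + 1)) 0 w) w := fun w hw => by
      have hw : ‖w‖ < 1 := by simpa using hw
      exact tsum_eq_dslope_polylog (n + 1) hw ▸ hasDerivAt_polylog_succ (n + 1) hw
    refine isOpen_ball.eqOn_of_deriv_eq (convex_ball (0 : ℂ) 1).isPreconnected
      (fun w hw => (hd1 w hw).differentiableAt.differentiableWithinAt)
      (fun w hw => (hd2 w hw).differentiableAt.differentiableWithinAt)
      (fun w hw => by rw [(hd1 w hw).deriv, (hd2 w hw).deriv])
      (mem_ball_self one_pos) (by simp [polylogExt_apply_zero]) (by simpa using hz)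

/-- On the circle the identity follows by continuity along the radius `r z`, `r → 1⁻`. Orders at
least 2 are needed for the series to be continuous on the closed disc. -/
lemma polylogExt_eq (n : ℕ) {z : ℂ} (hz : ‖z‖ ≤ 1) (h1 : z ≠ 1) :
    polylogExt (n + 1) z = polylog (n + 2) z := by
  have hc : Tendsto (fun r : ℝ => (r : ℂ) * z) (𝓝[<] 1) (𝓝 z) := by
    have : ContinuousAt (fun r : ℝ => (r : ℂ) * z) 1 := by fun_prop
    simpa using this.tendsto.mono_left nhdsWithin_le_nhds
  have hin : ∀ᶠ r : ℝ in 𝓝[<] 1, ‖(r : ℂ) * z‖ < 1 := by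
    filter_upwards [Ioo_mem_nhdsLT (zero_lt_one (α := ℝ))] with r hr
    rw [norm_mul, Complex.norm_real, Real.norm_of_nonneg hr.1.le]
    nlinarith [hr.1, hr.2, norm_nonneg z]
  have l1 : Tendsto (fun r : ℝ => polylogExt (n + 1) ((r : ℂ) * z)) (𝓝[<] 1)
      (𝓝 (polylogExt (n + 1) z)) :=
    (hasDerivAt_polylogExt_succ n (mem_bigDisc hz h1)).continuousAt.tendsto.comp hc
  have l2 : Tendsto (fun r : ℝ => polylog (n + 2) ((r : ℂ) * z)) (𝓝[<] 1)
      (𝓝 (polylog (n + 2) z)) := by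
    refine (continuousOn_polylog (by lia) z (by simpa using hz)).tendsto.comp
      (tendsto_nhdsWithin_iff.2 ⟨hc, ?_⟩)
    filter_upwards [hin] with r hr
    simpa using hr.le
  refine tendsto_nhds_unique l1 (l2.congr' ?_)
  filter_upwards [hin] with r hr
  exact (polylogExt_eq_of_norm_lt_one (n + 1) hr).symm

end ArctanLogSums

/-! ### Special values, Landen's identity and the trilogarithmic primitive. -/

namespace ArctanLogSums
open Complex Metric Set Filter Topology

lemma polylog_conj (s : ℕ) (z : ℂ) :
    polylog s (starRingEnd ℂ z) = starRingEnd ℂ (polylog s z) := by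
  simp only [polylog]
  rw [conj_tsum]
  congr 1 with n
  simp

lemma polylog_ofReal_im (s : ℕ) (x : ℝ) : (polylog s x).im = 0 := by
  rw [← Complex.conj_eq_iff_im, ← polylog_conj, Complex.conj_ofReal]

lemma polylog_I_im {s : ℕ} (hs : 2 ≤ s) : (polylog s I).im = dirichletBeta s := by
  have h := Complex.hasSum_im (summable_polylog hs (z := I) (by simp)).hasSum
  set f : ℕ → ℝ := fun n => (I ^ (n + 1) / ((n : ℂ) + 1) ^ s).im with hf
  have hodd (m : ℕ) : f (2 * m) = (-1 : ℝ) ^ m / (2 * (m : ℝ) + 1) ^ s := by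
    have : I ^ (2 * m + 1) / (((2 * m : ℕ) : ℂ) + 1) ^ s =
        (((-1 : ℝ) ^ m / (2 * (m : ℝ) + 1) ^ s : ℝ) : ℂ) * I := by
      rw [pow_succ, pow_mul, I_sq]
      push_cast
      ring
    rw [hf]
    simp only []
    rw [this, im_ofReal_mul, I_im, mul_one]
  have heven (m : ℕ) : f (2 * m + 1) = 0 := by
    have : I ^ (2 * m + 1 + 1) / (((2 * m + 1 : ℕ) : ℂ) + 1) ^ s =
        (((-1 : ℝ) ^ (m + 1) / (2 * (m : ℝ) + 1 + 1) ^ s : ℝ) : ℂ) := by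
      rw [show 2 * m + 1 + 1 = 2 * (m + 1) by ring, pow_mul, I_sq]
      push_cast
      ring
    rw [hf]
    simp only []
    rw [this, ofReal_im]
  have hs1 : Summable fun m : ℕ => f (2 * m) :=
    h.summable.comp_injective (i := fun m => 2 * m) fun a b hab => by simpa using hab
  have hs2 : Summable fun m : ℕ => f (2 * m + 1) :=
    h.summable.comp_injective (i := fun m => 2 * m + 1) fun a b hab => by simpa using hab
  have := tsum_even_add_odd hs1 hs2
  rw [h.tsum_eq] at this
  simp only [hodd, heven, tsum_zero, add_zero] at this
  exact this.symm

/-- Shaped to match the Fourier series of Bernoulli polynomials at `x = 1/4`. -/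
lemma I_pow_eq_exp (n : ℕ) :
    I ^ n = ((Real.cos (2 * Real.pi * n * (1 / 4)) : ℝ) : ℂ) +
      ((Real.sin (2 * Real.pi * n * (1 / 4)) : ℝ) : ℂ) * I := by
  have h : I ^ n = exp (Real.pi / 2 * I) ^ n := by rw [exp_pi_div_two_mul_I]
  rw [ofReal_cos, ofReal_sin, ← exp_mul_I, h, ← exp_nat_mul]
  congr 1
  push_cast
  ring

/-- The sum is `π² B₂(1/4)` with `B₂(1/4) = -1/48`. -/
lemma polylog_two_I_re : (polylog 2 I).re = -(Real.pi ^ 2 / 48) := by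
  have h := Complex.hasSum_re (summable_polylog le_rfl (z := I) (by simp)).hasSum
  have h2 := hasSum_one_div_nat_pow_mul_cos one_ne_zero (x := 1 / 4) (by constructor <;> norm_num)
  rw [← hasSum_nat_add_iff' 1] at h2
  have h3 := h.unique (h2.congr_fun fun n => ?_)
  · change (∑' n : ℕ, I ^ (n + 1) / ((n : ℂ) + 1) ^ 2).re = _
    rw [h3]
    simp [Polynomial.bernoulli, Finset.sum_range_succ, bernoulli, bernoulli'_two]
    ring
  · rw [I_pow_eq_exp]
    have : (((n : ℂ) + 1) ^ 2) = (((n : ℝ) + 1) ^ 2 : ℝ) := by push_cast; ring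
    rw [this, div_ofReal_re]
    simp only [add_re, ofReal_re, re_ofReal_mul, I_re]
    push_cast
    ring

/-- The sum is `(2π)³ / 12 · B₃(1/4)` with `B₃(1/4) = 3/64`. -/
lemma polylog_three_I_im : (polylog 3 I).im = Real.pi ^ 3 / 32 := by
  have h := Complex.hasSum_im (summable_polylog (s := 3) (by lia) (z := I) (by simp)).hasSum
  have h2 := hasSum_one_div_nat_pow_mul_sin one_ne_zero (x := 1 / 4) (by constructor <;> norm_num)
  rw [← hasSum_nat_add_iff' 1] at h2
  have h3 := h.unique (h2.congr_fun fun n => ?_)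
  · change (∑' n : ℕ, I ^ (n + 1) / ((n : ℂ) + 1) ^ 3).im = _
    rw [h3]
    simp [Polynomial.bernoulli, Finset.sum_range_succ, bernoulli, bernoulli'_two]
    ring
  · rw [I_pow_eq_exp]
    have : (((n : ℂ) + 1) ^ 3) = (((n : ℝ) + 1) ^ 3 : ℝ) := by push_cast; ring
    rw [this, div_ofReal_im]
    simp only [add_im, ofReal_im, im_ofReal_mul, I_im]
    push_cast
    ring

/-- The part of `bigDisc` in the half plane `Re z < 1/2`, which `z ↦ z / (z - 1)` maps into the
open unit disc. -/
abbrev landenDomain : Set ℂ := bigDisc ∩ {z | z.re < 1 / 2}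

lemma isOpen_landenDomain : IsOpen landenDomain :=
  isOpen_ball.inter (isOpen_lt continuous_re continuous_const)

lemma convex_landenDomain : Convex ℝ landenDomain :=
  (convex_ball _ _).inter (convex_halfSpace_re_lt _)

lemma zero_mem_landenDomain : (0 : ℂ) ∈ landenDomain :=
  ⟨mem_bigDisc (by simp) (by simp), by simp⟩

lemma norm_div_sub_one_lt_one {z : ℂ} (hz : z.re < 1 / 2) : ‖z / (z - 1)‖ < 1 := by
  have h0 : 0 < ‖z - 1‖ := by
    rw [norm_pos_iff, sub_ne_zero]
    rintro rfl
    norm_num at hz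
  rw [norm_div, div_lt_one h0, ← sq_lt_sq₀ (norm_nonneg _) h0.le, Complex.sq_norm,
    Complex.sq_norm, normSq_apply, normSq_apply]
  simp
  nlinarith

lemma log_one_sub_div_sub_one {z : ℂ} (hz : z.re < 1) :
    log (1 - z / (z - 1)) = -log (1 - z) := by
  have h1 : z - 1 ≠ 0 := by
    rw [sub_ne_zero]; rintro rfl; simp at hz
  have h2 : 1 - z ≠ 0 := by
    rw [sub_ne_zero]; rintro rfl; simp at hz
  rw [show 1 - z / (z - 1) = (1 - z)⁻¹ by field_simp; ring,
    log_inv _ (slitPlane_arg_ne_pi (one_sub_mem_slitPlane hz))]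

lemma hasDerivAt_div_sub_one {z : ℂ} (hz : z ≠ 1) :
    HasDerivAt (fun z : ℂ => z / (z - 1)) (-1 / (z - 1) ^ 2) z := by
  refine ((hasDerivAt_id' z).fun_div ((hasDerivAt_id' z).sub_const 1)
    (sub_ne_zero.2 hz)).congr_deriv ?_
  ring

lemma hasDerivAt_polylog_succ' (s : ℕ) {z : ℂ} (hz : ‖z‖ < 1) (h0 : z ≠ 0) :
    HasDerivAt (polylog (s + 1)) (polylog s z / z) z := by
  refine (hasDerivAt_polylog_succ s hz).congr_deriv ?_
  rw [tsum_eq_dslope_polylog s hz, dslope_of_ne _ h0, slope_def_field]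
  simp

lemma hasDerivAt_log_one_sub {z : ℂ} (hz : z.re < 1) :
    HasDerivAt (fun z : ℂ => log (1 - z)) (-1 / (1 - z)) z :=
  ((hasDerivAt_id' z).const_sub 1).clog (one_sub_mem_slitPlane hz)

/-- Landen's identity for the dilogarithm. -/
lemma polylog_two_div_sub_one {z : ℂ} (hz : z ∈ landenDomain) :
    polylog 2 (z / (z - 1)) = -polylogExt 1 z - log (1 - z) ^ 2 / 2 := by
  have key : ∀ z ∈ landenDomain, HasDerivAt
      (fun z => polylog 2 (z / (z - 1)) + polylogExt 1 z + log (1 - z) ^ 2 / 2) 0 z := by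
    rintro z ⟨hz, hz2⟩
    have hre : z.re < 1 := re_lt_one_of_mem_bigDisc hz
    have h1 : z ≠ 1 := by rintro rfl; simp at hre
    have hw := norm_div_sub_one_lt_one hz2
    have hd := (((hasDerivAt_polylog_succ 1 hw).comp z (hasDerivAt_div_sub_one h1)).add
      (hasDerivAt_polylogExt_succ 0 hz)).add
      (((hasDerivAt_log_one_sub hre).fun_pow 2).div_const 2)
    refine hd.congr_deriv ?_
    -- At 0 the quotient formulas for the slopes break down; there the two dilogarithms contribute
    -- `-1` and `1`, and the logarithm contributes 0.
    rcases eq_or_ne z 0 with rfl | h0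
    · rw [tsum_eq_dslope_polylog 1 hw, dslope_same,
        (hasDerivAt_polylogExt_zero (by simp)).deriv]
      simp only [zero_div]
      rw [dslope_same, (hasDerivAt_polylog_succ 0 (by simp)).deriv,
        tsum_eq_single 0 (by intro n hn; simp [hn])]
      simp
    · have h1' : z - 1 ≠ 0 := sub_ne_zero.2 h1
      have h1'' : 1 - z ≠ 0 := sub_ne_zero.2 h1.symm
      rw [tsum_eq_dslope_polylog 1 hw, dslope_of_ne _ (div_ne_zero h0 h1'), slope_def_field,
        dslope_polylogExt 0 h0, polylog_one hw, log_one_sub_div_sub_one hre]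
      simp only [polylogExt, polylog_zero_right, sub_zero]
      have : (z - 1) = -(1 - z) := by ring
      rw [this]
      field_simp
      ring
  have h := isOpen_landenDomain.is_const_of_deriv_eq_zero convex_landenDomain.isPreconnected
    (fun z hz => (key z hz).differentiableAt.differentiableWithinAt)
    (fun z hz => (key z hz).deriv) hz zero_mem_landenDomain
  simp only [zero_div, polylog_zero_right, polylogExt_apply_zero, sub_zero, log_one] at h
  linear_combination h

/-- A primitive of `log² (1 - z) / (2 z)` in terms of trilogarithms. -/
noncomputable def trilogPrimitive (z : ℂ) : ℂ :=
  polylog 3 (z / (z - 1)) + polylogExt 2 z - polylogExt 1 z * log (1 - z) - log (1 - z) ^ 3 / 6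

lemma continuousAt_trilogPrimitive {z : ℂ} (hz : z ∈ landenDomain) :
    ContinuousAt trilogPrimitive z := by
  have hre : z.re < 1 := re_lt_one_of_mem_bigDisc hz.1
  have h1 : z ≠ 1 := by rintro rfl; simp at hre
  have hl := (hasDerivAt_log_one_sub hre).continuousAt
  exact ((((hasDerivAt_polylog_succ 2 (norm_div_sub_one_lt_one hz.2)).comp z
    (hasDerivAt_div_sub_one h1)).continuousAt.add
    (hasDerivAt_polylogExt_succ 1 hz.1).continuousAt).sub
    ((hasDerivAt_polylogExt_succ 0 hz.1).continuousAt.mul hl)).sub ((hl.pow 3).div_const 6)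

/-- With `w = z / (z - 1)` one has `w' / w = 1/z + 1/(1 - z)`. Landen's identity rewrites `Li₂(w)`,
after which every dilogarithm and every `1/(1 - z)` term cancels. -/
lemma hasDerivAt_trilogPrimitive {z : ℂ} (hz : z ∈ landenDomain) (h0 : z ≠ 0) :
    HasDerivAt trilogPrimitive (log (1 - z) ^ 2 / (2 * z)) z := by
  have hre : z.re < 1 := re_lt_one_of_mem_bigDisc hz.1
  have h1 : z ≠ 1 := by rintro rfl; simp at hre
  have h1' : z - 1 ≠ 0 := sub_ne_zero.2 h1
  have h1'' : 1 - z ≠ 0 := sub_ne_zero.2 h1.symm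
  have hl := hasDerivAt_log_one_sub hre
  have hd := ((((hasDerivAt_polylog_succ' 2 (norm_div_sub_one_lt_one hz.2)
    (div_ne_zero h0 h1')).comp z (hasDerivAt_div_sub_one h1)).add
    (hasDerivAt_polylogExt_succ 1 hz.1)).sub
    ((hasDerivAt_polylogExt_succ 0 hz.1).mul hl)).sub ((hl.fun_pow 3).div_const 6)
  refine hd.congr_deriv ?_
  rw [polylog_two_div_sub_one hz, dslope_polylogExt 0 h0, dslope_polylogExt 1 h0]
  have : (z - 1) = -(1 - z) := by ring
  rw [this]
  simp only [polylogExt.eq_1]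
  field_simp
  ring

lemma trilogPrimitive_zero : trilogPrimitive 0 = 0 := by
  simp [trilogPrimitive, polylogExt_apply_zero]

/-- All ingredients are real at `-1`, since `z / (z - 1) = 1/2` and `1 - z = 2`. -/
lemma trilogPrimitive_neg_one_im : (trilogPrimitive (-1)).im = 0 := by
  have h1 : (-1 : ℂ) ≠ 1 := by norm_num
  have e1 : (-1 : ℂ) / (-1 - 1) = ((1 / 2 : ℝ) : ℂ) := by push_cast; norm_num
  have e2 : log (1 - -1) = ((Real.log 2 : ℝ) : ℂ) := by
    rw [show (1 - -1 : ℂ) = ((2 : ℝ) : ℂ) by push_cast; norm_num, ofReal_log (by norm_num)]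
  have e3 : (-1 : ℂ) = ((-1 : ℝ) : ℂ) := by simp
  rw [trilogPrimitive, e1, e2, polylogExt_eq 1 (by simp) h1, polylogExt_eq 0 (by simp) h1, e3]
  simp only [sub_im, add_im, polylog_ofReal_im, mul_im, ofReal_im, ofReal_re]
  rw [show (((Real.log 2 : ℝ) : ℂ) ^ 3 / 6) = ((Real.log 2 ^ 3 / 6 : ℝ) : ℂ) by push_cast; ring,
    ofReal_im]
  ring

lemma log_one_add_I : log (1 + I) = ((Real.log 2 / 2 : ℝ) : ℂ) + ((Real.pi / 4 : ℝ) : ℂ) * I := by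
  have h : (1 + I : ℂ) = exp (((Real.log 2 / 2 : ℝ) : ℂ) + ((Real.pi / 4 : ℝ) : ℂ) * I) := by
    rw [exp_add, exp_mul_I, ← ofReal_exp, ← ofReal_cos, ← ofReal_sin, Real.cos_pi_div_four,
      Real.sin_pi_div_four, Real.exp_half, Real.exp_log two_pos]
    have : Real.sqrt 2 * (Real.sqrt 2 / 2) = 1 := by
      rw [mul_div_assoc', Real.mul_self_sqrt (by norm_num)]; norm_num
    have h2 : ((Real.sqrt 2 : ℝ) : ℂ) * ((Real.sqrt 2 / 2 : ℝ) : ℂ) = 1 := by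
      rw [← ofReal_mul, this, ofReal_one]
    linear_combination (-1 - I) * h2
  rw [h, log_exp] <;>
    simp only [add_im, ofReal_im, im_ofReal_mul, I_im] <;> linarith [Real.pi_pos]

lemma trilogPrimitive_neg_I_im : (trilogPrimitive (-I)).im =
    W3 - 3 * Real.pi ^ 3 / 128 + catalanG * Real.log 2 / 2 - Real.pi * Real.log 2 ^ 2 / 32 := by
  have h1 : -I ≠ 1 := by
    intro h; simpa using congrArg re h
  have e1 : -I / (-I - 1) = (1 + I) / 2 := by
    have : -I - 1 ≠ 0 := by intro h; simpa using congrArg im h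
    field_simp
    linear_combination I_sq
  have hc : -I = starRingEnd ℂ I := by simp
  have hre : (polylog 2 (-I)).re = -(Real.pi ^ 2 / 48) := by
    rw [hc, polylog_conj, conj_re, polylog_two_I_re]
  have him : (polylog 2 (-I)).im = -catalanG := by
    rw [hc, polylog_conj, conj_im, polylog_I_im le_rfl, catalanG]
  have him3 : (polylog 3 (-I)).im = -(Real.pi ^ 3 / 32) := by
    rw [hc, polylog_conj, conj_im, polylog_three_I_im]
  rw [trilogPrimitive, e1, polylogExt_eq 1 (by simp) h1, polylogExt_eq 0 (by simp) h1,
    sub_neg_eq_add, log_one_add_I]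
  have hcube : ((((Real.log 2 / 2 : ℝ) : ℂ) + ((Real.pi / 4 : ℝ) : ℂ) * I) ^ 3 / 6).im =
      (3 * (Real.log 2 / 2) ^ 2 * (Real.pi / 4) - (Real.pi / 4) ^ 3) / 6 := by
    have : ((((Real.log 2 / 2 : ℝ) : ℂ) + ((Real.pi / 4 : ℝ) : ℂ) * I) ^ 3 / 6) =
        ((((Real.log 2 / 2) ^ 3 - 3 * (Real.log 2 / 2) * (Real.pi / 4) ^ 2) / 6 : ℝ) : ℂ) +
        (((3 * (Real.log 2 / 2) ^ 2 * (Real.pi / 4) - (Real.pi / 4) ^ 3) / 6 : ℝ) : ℂ) * I := by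
      push_cast
      linear_combination (3 * (((Real.log 2 : ℂ)) / 2) * (Real.pi / 4 : ℂ) ^ 2 +
        (Real.pi / 4 : ℂ) ^ 3 * I) / 6 * I_sq
    rw [this, add_im, ofReal_im, im_ofReal_mul, I_im]
    ring
  rw [sub_im, sub_im, add_im, hcube, mul_im, him3, him, hre]
  simp only [add_re, add_im, ofReal_re, ofReal_im, re_ofReal_mul, im_ofReal_mul, I_re, I_im]
  rw [W3]
  ring

end ArctanLogSums

/-! ### Polylogarithms on the unit circle and the integrals yielding `G` and `β(4)`. -/

namespace ArctanLogSums
open Complex Metric Set Filter Topology MeasureTheory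

lemma hasDerivAt_circle (c : ℂ) (t : ℝ) :
    HasDerivAt (fun t : ℝ => c * exp (2 * t * I)) (2 * I * (c * exp (2 * t * I))) t := by
  have h : HasDerivAt (fun t : ℝ => (2 * (t : ℂ) * I)) (2 * I) t := by
    simpa using ((hasDerivAt_id' t).ofReal_comp.const_mul 2).mul_const I
  refine (h.cexp.const_mul c).congr_deriv ?_
  ring

lemma norm_circle {c : ℂ} (hc : ‖c‖ = 1) (t : ℝ) : ‖c * exp (2 * t * I)‖ = 1 := by
  rw [norm_mul, hc, one_mul, show (2 * (t : ℂ) * I) = ((2 * t : ℝ) : ℂ) * I by push_cast; ring,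
    norm_exp_ofReal_mul_I]

/-- Along `z = c e^(2it)` one has `dz / z = 2i dt`, so differentiating in `t` just lowers the order.
The angle `2t` is chosen to make `1 + e^(2it) = 2 cos t e^(it)` have argument `t`. -/
lemma hasDerivAt_polylog_circle (n : ℕ) {c : ℂ} (hc : ‖c‖ = 1) {t : ℝ}
    (h1 : c * exp (2 * t * I) ≠ 1) :
    HasDerivAt (fun t : ℝ => polylog (n + 2) (c * exp (2 * t * I)))
      (2 * I * polylogExt n (c * exp (2 * t * I))) t := by
  have h0 : c * exp (2 * t * I) ≠ 0 := by
    rw [← norm_pos_iff, norm_circle hc]; exact one_pos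
  have hd : HasDerivAt (fun t : ℝ => polylogExt (n + 1) (c * exp (2 * t * I)))
      (2 * I * polylogExt n (c * exp (2 * t * I))) t := by
    refine ((hasDerivAt_polylogExt_succ n (mem_bigDisc (norm_circle hc t).le h1)).comp t
      (hasDerivAt_circle c t)).congr_deriv ?_
    rw [dslope_polylogExt n h0]
    generalize polylogExt n (c * exp (2 * t * I)) = a
    generalize c * exp (2 * t * I) = q at h0
    field_simp
  refine hd.congr_of_eventuallyEq ?_
  filter_upwards [(hasDerivAt_circle c t).continuousAt.eventually_ne h1] with u hu
  exact (polylogExt_eq n (norm_circle hc u).le hu).symm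

lemma continuous_polylog_circle {s : ℕ} (hs : 2 ≤ s) {c : ℂ} (hc : ‖c‖ = 1) :
    Continuous fun t : ℝ => polylog s (c * exp (2 * t * I)) :=
  (continuousOn_polylog hs).comp_continuous (by fun_prop)
    fun t => by simpa using (norm_circle hc t).le

lemma one_add_exp_two_mul_I (t : ℝ) :
    1 + exp (2 * t * I) = ((2 * Real.cos t : ℝ) : ℂ) * exp (t * I) := by
  have h : exp (2 * t * I) = exp (t * I) * exp (t * I) := by rw [← exp_add]; ring_nf
  rw [h, exp_mul_I]
  push_cast
  linear_combination - sin_sq_add_cos_sq (t : ℂ) + sin t ^ 2 * I_sq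

lemma one_sub_exp_two_mul_I (t : ℝ) :
    1 - exp (2 * t * I) = ((2 * Real.sin t : ℝ) : ℂ) * (-I * exp (t * I)) := by
  have h : exp (2 * t * I) = exp (t * I) * exp (t * I) := by rw [← exp_add]; ring_nf
  rw [h, exp_mul_I]
  push_cast
  linear_combination - sin_sq_add_cos_sq (t : ℂ) + sin t ^ 2 * I_sq

lemma log_one_add_exp {t : ℝ} (h1 : -(Real.pi / 2) < t) (h2 : t < Real.pi / 2) :
    log (1 + exp (2 * t * I)) = ((Real.log (2 * Real.cos t) : ℝ) : ℂ) + (t : ℂ) * I := by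
  have hc : 0 < 2 * Real.cos t := by
    have := Real.cos_pos_of_mem_Ioo ⟨h1, h2⟩
    positivity
  rw [one_add_exp_two_mul_I]
  have : ((2 * Real.cos t : ℝ) : ℂ) * exp (t * I) =
      exp (((Real.log (2 * Real.cos t) : ℝ) : ℂ) + (t : ℂ) * I) := by
    rw [exp_add, ← ofReal_exp, Real.exp_log hc]
  rw [this, log_exp] <;> simp only [add_im, ofReal_im, im_ofReal_mul, I_im] <;> linarith

lemma log_one_sub_exp_re {t : ℝ} (h1 : 0 < t) (h2 : t < Real.pi) :
    (log (1 - exp (2 * t * I))).re = Real.log (2 * Real.sin t) := by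
  have hs := Real.sin_pos_of_pos_of_lt_pi h1 h2
  rw [log_re, one_sub_exp_two_mul_I, norm_mul, norm_mul, norm_neg, norm_I, norm_exp_ofReal_mul_I,
    norm_real, Real.norm_of_nonneg (by positivity)]
  simp

lemma exp_two_mul_I_re (t : ℝ) : (exp (2 * t * I)).re = Real.cos (2 * t) := by
  rw [show (2 * (t : ℂ) * I) = ((2 * t : ℝ) : ℂ) * I by push_cast; ring, exp_ofReal_mul_I_re]

lemma exp_two_mul_I_ne_one {t : ℝ} (h1 : 0 < t) (h2 : t < Real.pi / 2) :
    1 * exp (2 * t * I) ≠ 1 := by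
  intro h
  have := one_sub_exp_two_mul_I t
  rw [one_mul] at h
  rw [h, sub_self] at this
  have hs := Real.sin_pos_of_pos_of_lt_pi h1 (by linarith [Real.pi_pos])
  have h3 := congrArg norm this
  rw [norm_mul, norm_mul, norm_neg, norm_I, norm_exp_ofReal_mul_I, norm_real,
    Real.norm_of_nonneg (by positivity)] at h3
  simp at h3
  exact hs.ne' h3

lemma neg_exp_two_mul_I_ne_one {t : ℝ} (h1 : -(Real.pi / 2) < t) (h2 : t < Real.pi / 2) :
    -1 * exp (2 * t * I) ≠ 1 := by
  intro h
  have := one_add_exp_two_mul_I t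
  have hc := Real.cos_pos_of_mem_Ioo ⟨h1, h2⟩
  rw [show 1 + exp (2 * t * I) = 0 by linear_combination -h] at this
  have h3 := congrArg norm this
  rw [norm_mul, norm_exp_ofReal_mul_I, norm_real, Real.norm_of_nonneg (by positivity)] at h3
  simp at h3
  exact hc.ne' h3

/-- Legendre's chi function `χ_s` at the point `exp (2 i t)` of the unit circle. -/
noncomputable def chiCircle (s : ℕ) (t : ℝ) : ℂ :=
  (polylog s (1 * exp (2 * t * I)) - polylog s (-1 * exp (2 * t * I))) / 2

lemma continuous_chiCircle {s : ℕ} (hs : 2 ≤ s) : Continuous (chiCircle s) :=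
  ((continuous_polylog_circle hs (by simp)).sub
    (continuous_polylog_circle hs (by simp))).div_const 2

lemma hasDerivAt_chiCircle (n : ℕ) {t : ℝ} (h1 : 0 < t) (h2 : t < Real.pi / 2) :
    HasDerivAt (chiCircle (n + 3)) (2 * I * chiCircle (n + 2) t) t := by
  have e1 := exp_two_mul_I_ne_one h1 h2
  have e2 := neg_exp_two_mul_I_ne_one (by linarith) h2
  refine (((hasDerivAt_polylog_circle (n + 1) (by simp) e1).sub
    (hasDerivAt_polylog_circle (n + 1) (by simp) e2)).div_const 2).congr_deriv ?_
  rw [polylogExt_eq n (norm_circle (by simp) t).le e1,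
    polylogExt_eq n (norm_circle (by simp) t).le e2, chiCircle]
  ring

/-- At order 1 the chi function is `½ log ((1 + z) / (1 - z))`, and `|(1 + z) / (1 - z)| = cot t` at
`z = e^(2it)`. -/
lemma hasDerivAt_chiCircle_two_im {t : ℝ} (h1 : 0 < t) (h2 : t < Real.pi / 2) :
    HasDerivAt (fun t => (chiCircle 2 t).im) (-Real.log (Real.tan t)) t := by
  have e1 := exp_two_mul_I_ne_one h1 h2
  have e2 := neg_exp_two_mul_I_ne_one (by linarith) h2
  have h := ((hasDerivAt_polylog_circle 0 (by simp) e1).sub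
    (hasDerivAt_polylog_circle 0 (by simp) e2)).div_const 2
  have h' := imCLM.hasFDerivAt.comp_hasDerivAt t h
  refine h'.congr_deriv ?_
  have hs := Real.sin_pos_of_pos_of_lt_pi h1 (by linarith [Real.pi_pos])
  have hc := Real.cos_pos_of_mem_Ioo ⟨by linarith, h2⟩
  simp only [polylogExt, imCLM_apply]
  rw [show 1 - -1 * exp (2 * t * I) = 1 + exp (2 * t * I) by ring, one_mul,
    show (2 * I * -log (1 - exp (2 * t * I)) - 2 * I * -log (1 + exp (2 * t * I))) / 2 =
      (log (1 + exp (2 * t * I)) - log (1 - exp (2 * t * I))) * I by ring, mul_I_im, sub_re,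
    log_one_sub_exp_re h1 (by linarith [Real.pi_pos]), log_one_add_exp (by linarith) h2,
    Real.tan_eq_sin_div_cos, Real.log_div hs.ne' hc.ne', Real.log_mul two_ne_zero hs.ne',
    Real.log_mul two_ne_zero hc.ne']
  simp only [add_re, ofReal_re, re_ofReal_mul, I_re]
  ring

lemma exp_two_mul_pi_div_four : exp (2 * (Real.pi / 4 : ℝ) * I) = I := by
  rw [show (2 * ((Real.pi / 4 : ℝ) : ℂ) * I) = Real.pi / 2 * I by push_cast; ring,
    exp_pi_div_two_mul_I]

/-- `Li_s(-i)` is the conjugate of `Li_s(i)`, so only the imaginary part survives. -/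
lemma chiCircle_pi_div_four {s : ℕ} (hs : 2 ≤ s) :
    chiCircle s (Real.pi / 4) = dirichletBeta s * I := by
  rw [chiCircle, exp_two_mul_pi_div_four, one_mul, neg_one_mul, ← conj_I, polylog_conj,
    ← polylog_I_im hs, sub_conj]
  push_cast
  ring

lemma chiCircle_zero_im (s : ℕ) : (chiCircle s 0).im = 0 := by
  have h : chiCircle s 0 = (polylog s (1 : ℝ) - polylog s (-1 : ℝ)) / (2 : ℝ) := by
    simp [chiCircle]
  rw [h, div_ofReal_im, sub_im, polylog_ofReal_im, polylog_ofReal_im]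
  simp

lemma pi_div_four_pos : 0 < Real.pi / 4 := by positivity

lemma tan_mem_Ioo {t : ℝ} (ht : t ∈ Ioo 0 (Real.pi / 4)) : Real.tan t ∈ Ioo 0 1 := by
  have h1 := Real.tan_pos_of_pos_of_lt_pi_div_two ht.1 (by linarith [ht.2, Real.pi_pos])
  refine ⟨h1, ?_⟩
  rw [← Real.tan_pi_div_four]
  exact Real.tan_lt_tan_of_lt_of_lt_pi_div_two (by linarith [ht.1, Real.pi_pos])
    (by linarith [Real.pi_pos]) ht.2

/-- The integrand is unbounded at 0, but `-log tan` is a nonnegative derivative of a function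
continuous up to the endpoints, which forces integrability. -/
lemma intervalIntegrable_log_tan :
    IntervalIntegrable (fun t => Real.log (Real.tan t)) volume 0 (Real.pi / 4) := by
  have h : IntervalIntegrable (fun t => -Real.log (Real.tan t)) volume 0 (Real.pi / 4) := by
    rw [intervalIntegrable_iff_integrableOn_Ioc_of_le pi_div_four_pos.le]
    refine intervalIntegral.integrableOn_deriv_of_nonneg
      (continuous_im.comp (continuous_chiCircle le_rfl)).continuousOn
      (fun t ht => hasDerivAt_chiCircle_two_im ht.1 (by linarith [ht.2, ht.1, Real.pi_pos]))
      fun t ht => ?_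
    have := tan_mem_Ioo ht
    have := Real.log_nonpos this.1.le this.2.le
    linarith
  simpa [Pi.neg_def] using h.neg

lemma integral_log_tan : ∫ t in 0..Real.pi / 4, Real.log (Real.tan t) = -catalanG := by
  have h := intervalIntegral.integral_eq_sub_of_hasDerivAt_of_le pi_div_four_pos.le
    (continuous_im.comp (continuous_chiCircle le_rfl)).neg.continuousOn
    (fun t ht => (hasDerivAt_chiCircle_two_im ht.1
      (by linarith [ht.2, ht.1, Real.pi_pos])).neg.congr_deriv (neg_neg _))
    intervalIntegrable_log_tan
  rw [h]
  simp only [Pi.neg_apply, Function.comp_apply, chiCircle_zero_im, chiCircle_pi_div_four le_rfl,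
    im_ofReal_mul, I_im, catalanG]
  ring

lemma integral_log_tan_mul_sq : ∫ t in 0..Real.pi / 4, Real.log (Real.tan t) * t ^ 2 =
    -catalanG * Real.pi ^ 2 / 16 + dirichletBeta 4 / 2 := by
  have hint : IntervalIntegrable (fun t => Real.log (Real.tan t) * t ^ 2) volume
      0 (Real.pi / 4) :=
    intervalIntegrable_log_tan.mul_continuousOn (by fun_prop)
  have c2 := continuous_im.comp (continuous_chiCircle (s := 2) le_rfl)
  have c3 := continuous_re.comp (continuous_chiCircle (s := 3) (by lia))
  have c4 := continuous_im.comp (continuous_chiCircle (s := 4) (by lia))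
  -- The primitive obtained by integrating by parts twice, with the chi functions of orders 2, 3 and
  -- 4. At `π/4` the order 3 term drops out because `χ₃(i)` is purely imaginary.
  have hcont : Continuous fun t : ℝ => -(t ^ 2 * (chiCircle 2 t).im) - t * (chiCircle 3 t).re +
      (chiCircle 4 t).im / 2 :=
    ((((continuous_id.pow 2).mul c2).neg).sub (continuous_id.mul c3)).add (c4.div_const 2)
  have h := intervalIntegral.integral_eq_sub_of_hasDerivAt_of_le pi_div_four_pos.le
    hcont.continuousOn (fun t ht => ?_) hint
  · rw [h]
    simp only [chiCircle_zero_im, chiCircle_pi_div_four (le_refl 2),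
      chiCircle_pi_div_four (by lia : 2 ≤ 3), chiCircle_pi_div_four (by lia : 2 ≤ 4),
      im_ofReal_mul, re_ofReal_mul, I_im, I_re, catalanG]
    ring
  · have ht2 : t < Real.pi / 2 := by linarith [ht.2, ht.1, Real.pi_pos]
    have d2 := hasDerivAt_chiCircle_two_im ht.1 ht2
    have d3 := reCLM.hasFDerivAt.comp_hasDerivAt t (hasDerivAt_chiCircle 0 ht.1 ht2)
    have d4 := imCLM.hasFDerivAt.comp_hasDerivAt t (hasDerivAt_chiCircle 1 ht.1 ht2)
    refine (((((hasDerivAt_pow 2 t).mul d2).neg).sub ((hasDerivAt_id' t).mul d3)).add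
      (d4.div_const 2)).congr_deriv ?_
    simp only [reCLM_apply, imCLM_apply, Function.comp_apply]
    simp [mul_re, mul_im]
    ring

lemma integral_mul_tan : ∫ t in 0..Real.pi / 4, t * Real.tan t =
    catalanG / 2 - Real.pi * Real.log 2 / 8 := by
  have hcos : ∀ t ∈ Icc 0 (Real.pi / 4), 0 < Real.cos t := fun t ht =>
    Real.cos_pos_of_mem_Ioo ⟨by linarith [ht.1, Real.pi_pos], by linarith [ht.2, Real.pi_pos]⟩
  have hint : IntervalIntegrable (fun t => t * Real.tan t) volume 0 (Real.pi / 4) := by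
    apply ContinuousOn.intervalIntegrable_of_Icc pi_div_four_pos.le
    exact continuousOn_id.mul fun t ht =>
      (Real.continuousAt_tan.2 (hcos t ht).ne').continuousWithinAt
  -- By parts: `-log (2 cos t)` is a primitive of `tan t`, and it is integrated in turn as the real
  -- part of `-log (1 + e^(2it))`.
  have hcont : ContinuousOn (fun t : ℝ => -(t * Real.log (2 * Real.cos t)) -
      (polylog 2 (-1 * exp (2 * t * I))).im / 2) (Icc 0 (Real.pi / 4)) := by
    refine ((continuousOn_id.mul (ContinuousOn.log (by fun_prop) fun t ht => ?_)).neg).sub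
      ((continuous_im.comp (continuous_polylog_circle le_rfl (by simp))).div_const 2).continuousOn
    have := hcos t ht
    positivity
  have h := intervalIntegral.integral_eq_sub_of_hasDerivAt_of_le pi_div_four_pos.le
    hcont (fun t ht => ?_) hint
  · rw [h, exp_two_mul_pi_div_four, neg_one_mul, ← conj_I, polylog_conj, conj_im,
      polylog_I_im le_rfl, Real.cos_pi_div_four, show 2 * (Real.sqrt 2 / 2) = Real.sqrt 2 by ring,
      Real.log_sqrt (by norm_num), ofReal_zero, mul_zero, zero_mul, zero_mul, exp_zero, mul_one,
      show (-1 : ℂ) = ((-1 : ℝ) : ℂ) by simp, polylog_ofReal_im, catalanG]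
    ring
  · have hc := hcos t (Ioo_subset_Icc_self ht)
    have l1 : -(Real.pi / 2) < t := by linarith [ht.1, Real.pi_pos]
    have l2 : t < Real.pi / 2 := by linarith [ht.2, ht.1, Real.pi_pos]
    have d1 := imCLM.hasFDerivAt.comp_hasDerivAt t
      (hasDerivAt_polylog_circle 0 (c := -1) (by simp) (neg_exp_two_mul_I_ne_one l1 l2))
    have d2 := ((Real.hasDerivAt_cos t).const_mul 2).log (by positivity)
    refine ((((hasDerivAt_id' t).mul d2).neg).sub (d1.div_const 2)).congr_deriv ?_
    simp only [polylogExt, imCLM_apply]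
    rw [show 1 - -1 * exp (2 * t * I) = 1 + exp (2 * t * I) by ring, log_one_add_exp l1 l2,
      Real.tan_eq_sin_div_cos]
    simp
    field_simp
    ring

end ArctanLogSums

/-! ### The weight-three integrals in `log tan`, `log cos` and `t`. -/

namespace ArctanLogSums
open Complex Metric Set Filter Topology MeasureTheory

lemma tendsto_tan_nhdsGT_zero : Tendsto Real.tan (𝓝[>] 0) (𝓝[>] 0) := by
  refine tendsto_nhdsWithin_iff.2 ⟨?_, ?_⟩
  · have : ContinuousAt Real.tan 0 := Real.continuousAt_tan.2 (by simp)
    simpa using this.tendsto.mono_left nhdsWithin_le_nhds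
  · filter_upwards [Ioo_mem_nhdsGT pi_div_four_pos] with t ht
    exact (tan_mem_Ioo ht).1

lemma tendsto_log_tan_mul_tan :
    Tendsto (fun t => Real.log (Real.tan t) * Real.tan t) (𝓝[>] 0) (𝓝 0) := by
  have := (tendsto_log_mul_rpow_nhdsGT_zero one_pos).comp tendsto_tan_nhdsGT_zero
  simpa [Function.comp_def] using this

/-- It is the square of `log u · u^(1/2)` at `u = tan t`. -/
lemma tendsto_log_tan_sq_mul_tan :
    Tendsto (fun t => Real.log (Real.tan t) ^ 2 * Real.tan t) (𝓝[>] 0) (𝓝 0) := by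
  have := ((tendsto_log_mul_rpow_nhdsGT_zero one_half_pos).comp tendsto_tan_nhdsGT_zero).pow 2
  simp only [Function.comp_def, mul_pow, ne_eq, OfNat.ofNat_ne_zero, not_false_eq_true,
    zero_pow] at this
  refine this.congr' ?_
  filter_upwards [Ioo_mem_nhdsGT pi_div_four_pos] with t ht
  rw [← Real.rpow_natCast (Real.tan t ^ (1 / 2 : ℝ)), ← Real.rpow_mul (tan_mem_Ioo ht).1.le]
  norm_num

/-- A function that is dominated near `0` by one tending to `0` is continuous on `[0, b]` if it
vanishes at `0` and is continuous at the other points. -/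
lemma continuousOn_Icc_of_bound {f g : ℝ → ℝ} {b : ℝ} (h0 : f 0 = 0)
    (hf : ∀ t ∈ Ioc 0 b, ContinuousWithinAt f (Icc 0 b) t)
    (hg : Tendsto g (𝓝[>] 0) (𝓝 0)) (hfg : ∀ t ∈ Ioo 0 b, |f t| ≤ g t) :
    ContinuousOn f (Icc 0 b) := by
  rintro t ⟨h1, h2⟩
  rcases h1.eq_or_lt with rfl | h1
  · rcases h2.eq_or_lt with rfl | h2
    · simp
    · have hlim : Tendsto f (𝓝[>] 0) (𝓝 0) := by
        refine squeeze_zero_norm' ?_ hg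
        filter_upwards [Ioo_mem_nhdsGT h2] with t ht using hfg t ht
      have h3 : ContinuousWithinAt f (Ioi 0) 0 := by
        rw [ContinuousWithinAt, h0]; exact hlim
      exact (continuousWithinAt_Ioi_iff_Ici.1 h3).mono fun x hx => hx.1
  · exact hf t ⟨h1, h2⟩

lemma cos_pos_of_mem_Icc {t : ℝ} (ht : t ∈ Icc 0 (Real.pi / 4)) : 0 < Real.cos t :=
  Real.cos_pos_of_mem_Ioo ⟨by linarith [ht.1, Real.pi_pos], by linarith [ht.2, Real.pi_pos]⟩

lemma continuousAt_log_tan {t : ℝ} (ht : t ∈ Ioc 0 (Real.pi / 4)) :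
    ContinuousAt (fun t => Real.log (Real.tan t)) t :=
  (Real.continuousAt_tan.2 (cos_pos_of_mem_Icc ⟨ht.1.le, ht.2⟩).ne').log
    (Real.tan_pos_of_pos_of_lt_pi_div_two ht.1 (by linarith [ht.1, ht.2, Real.pi_pos])).ne'

lemma hasDerivAt_log_tan {t : ℝ} (ht : t ∈ Ioo 0 (Real.pi / 4)) :
    HasDerivAt (fun t => Real.log (Real.tan t)) (1 / Real.cos t ^ 2 / Real.tan t) t :=
  (Real.hasDerivAt_tan (cos_pos_of_mem_Icc (Ioo_subset_Icc_self ht)).ne').log (tan_mem_Ioo ht).1.ne'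

lemma log_one_add_tan_mul_I {t : ℝ} (ht : t ∈ Icc 0 (Real.pi / 4)) :
    log (1 + Real.tan t * I) = ((-Real.log (Real.cos t) : ℝ) : ℂ) + (t : ℂ) * I := by
  have hc := cos_pos_of_mem_Icc ht
  have hc' : cos (t : ℂ) ≠ 0 := by rw [← ofReal_cos]; exact_mod_cast hc.ne'
  have h : 1 + Real.tan t * I = exp (((-Real.log (Real.cos t) : ℝ) : ℂ) + (t : ℂ) * I) := by
    rw [exp_add, ← ofReal_exp, Real.exp_neg, Real.exp_log hc, exp_mul_I, Real.tan_eq_sin_div_cos]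
    push_cast
    field_simp
  rw [h, log_exp] <;> simp only [add_im, ofReal_im, im_ofReal_mul, I_im] <;>
    linarith [ht.1, ht.2, Real.pi_pos]

/-- Linear vanishing at 0 is what absorbs the logarithm in `log tan t · Ti₂(tan t)`. -/
lemma norm_polylog_two_le {z : ℂ} (hz : ‖z‖ ≤ 1) :
    ‖polylog 2 z‖ ≤ (∑' n : ℕ, 1 / ((n : ℝ) + 1) ^ 2) * ‖z‖ := by
  refine tsum_of_norm_bounded ((summable_one_div_succ_pow le_rfl).hasSum.mul_right ‖z‖) fun n => ?_
  rw [pow_succ, mul_div_right_comm, norm_mul]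
  gcongr
  have h : ‖(n : ℂ) + 1‖ = (n : ℝ) + 1 := by
    have := Complex.norm_natCast (n + 1)
    push_cast at this
    exact this
  rw [norm_div, norm_pow, norm_pow, h]
  gcongr
  exact pow_le_one₀ (norm_nonneg _) hz

/-- The inverse tangent integral `Ti_s`. -/
noncomputable def invTan (s : ℕ) (x : ℝ) : ℝ := (polylog s (x * I)).im

lemma continuousOn_invTan {s : ℕ} (hs : 2 ≤ s) : ContinuousOn (invTan s) (Icc 0 1) :=
  continuous_im.comp_continuousOn <| (continuousOn_polylog hs).comp (by fun_prop) fun x hx => by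
    simp [abs_le]; constructor <;> linarith [hx.1, hx.2]

lemma hasDerivAt_invTan_succ (s : ℕ) {x : ℝ} (hx : x ∈ Ioo 0 1) :
    HasDerivAt (invTan (s + 1)) (invTan s x / x) x := by
  have h0 : (x : ℂ) * I ≠ 0 := mul_ne_zero (by exact_mod_cast hx.1.ne') I_ne_zero
  have hn : ‖(x : ℂ) * I‖ < 1 := by simp [abs_lt]; constructor <;> linarith [hx.1, hx.2]
  have h1 : HasDerivAt (fun x : ℝ => (x : ℂ) * I) I x := by
    simpa using (hasDerivAt_id' x).ofReal_comp.mul_const I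
  refine (imCLM.hasFDerivAt.comp_hasDerivAt x
    ((hasDerivAt_polylog_succ' s hn h0).comp x h1)).congr_deriv ?_
  rw [show polylog s (x * I) / (x * I) * I = polylog s (x * I) / x by
    have : (x : ℂ) ≠ 0 := by exact_mod_cast hx.1.ne'
    field_simp]
  rw [imCLM_apply, div_ofReal_im, invTan]

/-- `Ti₁` is the arctangent: it is the argument of `1 + i tan t`. -/
lemma invTan_one_tan {t : ℝ} (ht : t ∈ Ioo 0 (Real.pi / 4)) : invTan 1 (Real.tan t) = t := by
  have hx := tan_mem_Ioo ht
  have hn : ‖((-Real.tan t : ℝ) : ℂ) * I‖ < 1 := by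
    rw [norm_mul, norm_I, mul_one, norm_real, norm_neg, Real.norm_of_nonneg hx.1.le]
    exact hx.2
  have hc : ((Real.tan t : ℝ) : ℂ) * I = starRingEnd ℂ (((-Real.tan t : ℝ) : ℂ) * I) := by
    rw [map_mul, conj_I, conj_ofReal]
    push_cast
    ring
  rw [invTan, hc, polylog_conj, conj_im, polylog_one hn,
    show 1 - ((-Real.tan t : ℝ) : ℂ) * I = 1 + Real.tan t * I by push_cast; ring,
    log_one_add_tan_mul_I (Ioo_subset_Icc_self ht)]
  simp

lemma tan_mem_Icc {t : ℝ} (ht : t ∈ Icc 0 (Real.pi / 4)) : Real.tan t ∈ Icc 0 1 := by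
  rcases ht.1.eq_or_lt with rfl | h1
  · simp
  rcases ht.2.eq_or_lt with rfl | h2
  · simp
  exact Ioo_subset_Icc_self (tan_mem_Ioo ⟨h1, h2⟩)

lemma continuousOn_tan_Icc : ContinuousOn Real.tan (Icc 0 (Real.pi / 4)) := fun _ ht =>
  (Real.continuousAt_tan.2 (cos_pos_of_mem_Icc ht).ne').continuousWithinAt

/-- A primitive of `log² tan t`. -/
noncomputable def logTanSqPrimitive (t : ℝ) : ℝ :=
  Real.log (Real.tan t) ^ 2 * t - 2 * (Real.log (Real.tan t) * invTan 2 (Real.tan t)) +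
    2 * invTan 3 (Real.tan t)

lemma continuousOn_logTanSqPrimitive :
    ContinuousOn logTanSqPrimitive (Icc 0 (Real.pi / 4)) := by
  have hTi {s : ℕ} (hs : 2 ≤ s) :
      ContinuousOn (fun t => invTan s (Real.tan t)) (Icc 0 (Real.pi / 4)) :=
    (continuousOn_invTan hs).comp continuousOn_tan_Icc fun t ht => tan_mem_Icc ht
  refine ((continuousOn_Icc_of_bound (by simp) (fun t ht => ?_) tendsto_log_tan_sq_mul_tan
    fun t ht => ?_).sub (continuousOn_const.mul (continuousOn_Icc_of_bound (by simp)
      (fun t ht => ?_) (g := fun t => (∑' n : ℕ, 1 / ((n : ℝ) + 1) ^ 2) *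
        |Real.log (Real.tan t) * Real.tan t|) ?_ fun t ht => ?_))).add
    (continuousOn_const.mul (hTi (by lia)))
  · exact ((continuousAt_log_tan ht).pow 2 |>.mul continuousAt_id).continuousWithinAt
  · rw [abs_mul, abs_of_nonneg (sq_nonneg _), abs_of_pos ht.1]
    gcongr
    exact Real.le_tan ht.1.le (by linarith [ht.1, ht.2, Real.pi_pos])
  · exact (continuousAt_log_tan ht).continuousWithinAt.mul (hTi le_rfl t ⟨ht.1.le, ht.2⟩)
  · have := tendsto_log_tan_mul_tan.abs.const_mul (∑' n : ℕ, 1 / ((n : ℝ) + 1) ^ 2)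
    rwa [abs_zero, mul_zero] at this
  · have hx := tan_mem_Ioo ht
    have hn : ‖((Real.tan t : ℝ) : ℂ) * I‖ = Real.tan t := by
      rw [norm_mul, norm_I, mul_one, norm_real, Real.norm_of_nonneg hx.1.le]
    have h1 : |invTan 2 (Real.tan t)| ≤ (∑' n : ℕ, 1 / ((n : ℝ) + 1) ^ 2) * Real.tan t := by
      refine (abs_im_le_norm _).trans ((norm_polylog_two_le (by rw [hn]; exact hx.2.le)).trans ?_)
      rw [hn]
    rw [abs_mul, abs_mul, abs_of_pos hx.1]
    calc _ ≤ |Real.log (Real.tan t)| * ((∑' n : ℕ, 1 / ((n : ℝ) + 1) ^ 2) * Real.tan t) := by gcongr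
      _ = _ := by ring

lemma hasDerivAt_logTanSqPrimitive {t : ℝ} (ht : t ∈ Ioo 0 (Real.pi / 4)) :
    HasDerivAt logTanSqPrimitive (Real.log (Real.tan t) ^ 2) t := by
  have hl := hasDerivAt_log_tan ht
  have hx := tan_mem_Ioo ht
  have hc := cos_pos_of_mem_Icc (Ioo_subset_Icc_self ht)
  have htan := Real.hasDerivAt_tan hc.ne'
  refine ((((hl.fun_pow 2).mul (hasDerivAt_id' t)).sub
    ((hl.mul ((hasDerivAt_invTan_succ 1 hx).comp t htan)).const_mul 2)).add
    (((hasDerivAt_invTan_succ 2 hx).comp t htan).const_mul 2)).congr_deriv ?_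
  simp only [Function.comp_apply]
  rw [invTan_one_tan ht]
  have := hx.1
  field_simp
  ring

lemma intervalIntegrable_log_tan_sq :
    IntervalIntegrable (fun t => Real.log (Real.tan t) ^ 2) volume 0 (Real.pi / 4) := by
  rw [intervalIntegrable_iff_integrableOn_Ioc_of_le pi_div_four_pos.le]
  exact intervalIntegral.integrableOn_deriv_of_nonneg continuousOn_logTanSqPrimitive
    (fun t ht => hasDerivAt_logTanSqPrimitive ht) fun t _ => sq_nonneg _

lemma integral_log_tan_sq :
    ∫ t in 0..Real.pi / 4, Real.log (Real.tan t) ^ 2 = Real.pi ^ 3 / 16 := by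
  rw [intervalIntegral.integral_eq_sub_of_hasDerivAt_of_le pi_div_four_pos.le
    continuousOn_logTanSqPrimitive (fun t ht => hasDerivAt_logTanSqPrimitive ht)
    intervalIntegrable_log_tan_sq]
  simp [logTanSqPrimitive, invTan, polylog_three_I_im]
  ring

lemma continuousOn_log_two_mul_cos :
    ContinuousOn (fun t => Real.log (2 * Real.cos t)) (Icc 0 (Real.pi / 4)) :=
  ContinuousOn.log (by fun_prop) fun t ht => by
    have := cos_pos_of_mem_Icc ht
    positivity

/-- Follow `trilogPrimitive` along `z = -e^(2it)` from `-1` to `-i`. There `dz / (2z) = i dt` and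
`log (1 - z) = log (2 cos t) + i t`, so the imaginary part integrates `log² (2 cos t) - t²`. -/
lemma integral_log_two_mul_cos_sq : ∫ t in 0..Real.pi / 4, Real.log (2 * Real.cos t) ^ 2 =
    (trilogPrimitive (-I)).im + Real.pi ^ 3 / 192 := by
  have hpi := Real.pi_pos
  have hcont : ContinuousOn (fun t : ℝ => Real.log (2 * Real.cos t) ^ 2 - t ^ 2)
      (Icc 0 (Real.pi / 4)) :=
    (continuousOn_log_two_mul_cos.pow 2).sub (by fun_prop)
  have hd : ∀ t ∈ uIcc 0 (Real.pi / 4),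
      HasDerivAt (fun t : ℝ => (trilogPrimitive (-1 * exp (2 * t * I))).im)
        (Real.log (2 * Real.cos t) ^ 2 - t ^ 2) t := fun t ht => by
    rw [uIcc_of_le pi_div_four_pos.le] at ht
    have l1 : -(Real.pi / 2) < t := by linarith [ht.1]
    have l2 : t < Real.pi / 2 := by linarith [ht.2]
    have h0 : -1 * exp (2 * t * I) ≠ 0 := by
      rw [← norm_pos_iff, norm_circle (by simp)]; exact one_pos
    have hmem : -1 * exp (2 * t * I) ∈ landenDomain := by
      refine ⟨mem_bigDisc (norm_circle (by simp) t).le (neg_exp_two_mul_I_ne_one l1 l2), ?_⟩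
      have : 0 ≤ Real.cos (2 * t) :=
        Real.cos_nonneg_of_mem_Icc ⟨by linarith [ht.1], by linarith [ht.2]⟩
      simp only [mem_ofPred_eq, neg_one_mul, neg_re, exp_two_mul_I_re]
      linarith
    refine (imCLM.hasFDerivAt.comp_hasDerivAt t ((hasDerivAt_trilogPrimitive hmem h0).comp t
      (hasDerivAt_circle (-1) t))).congr_deriv ?_
    rw [show log (1 - -1 * exp (2 * t * I)) ^ 2 / (2 * (-1 * exp (2 * t * I))) *
      (2 * I * (-1 * exp (2 * t * I))) = log (1 - -1 * exp (2 * t * I)) ^ 2 * I by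
        field_simp,
      imCLM_apply, mul_I_im, show 1 - -1 * exp (2 * t * I) = 1 + exp (2 * t * I) by ring,
      log_one_add_exp l1 l2, sq, mul_re]
    simp only [add_re, add_im, ofReal_re, ofReal_im, re_ofReal_mul, im_ofReal_mul, I_re, I_im]
    ring
  have hint := ContinuousOn.intervalIntegrable_of_Icc (μ := volume) pi_div_four_pos.le hcont
  have h := intervalIntegral.integral_eq_sub_of_hasDerivAt hd hint
  have hint2 : IntervalIntegrable (fun t => Real.log (2 * Real.cos t) ^ 2) volume 0 (Real.pi / 4) :=
    ContinuousOn.intervalIntegrable_of_Icc pi_div_four_pos.le (continuousOn_log_two_mul_cos.pow 2)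
  rw [intervalIntegral.integral_sub hint2
    (by apply Continuous.intervalIntegrable; fun_prop), integral_pow, exp_two_mul_pi_div_four] at h
  have e : trilogPrimitive (-1 * exp (2 * ((0 : ℝ) : ℂ) * I)) = trilogPrimitive (-1) := by simp
  rw [e, trilogPrimitive_neg_one_im, neg_one_mul] at h
  linear_combination h

/-- From the double-angle formula for the sine. -/
lemma integral_log_two_mul_cos_mul_log_tan :
    ∫ t in 0..Real.pi / 4, Real.log (2 * Real.cos t) * Real.log (Real.tan t) =
      -(∫ t in 0..Real.pi / 4, Real.log (2 * Real.cos t) ^ 2) - Real.pi ^ 3 / 96 := by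
  have hpi := Real.pi_pos
  set A : ℝ → ℝ := fun t => Real.log (2 * Real.cos t) with hA
  set l : ℝ → ℝ := fun t => Real.log (Real.tan t) with hl
  set B : ℝ → ℝ := fun t => Real.log (2 * Real.sin t) with hB
  have hBA : ∀ t ∈ Ioo 0 (Real.pi / 4), B t = l t + A t := fun t ht => by
    have hc := cos_pos_of_mem_Icc (Ioo_subset_Icc_self ht)
    have hs := Real.sin_pos_of_pos_of_lt_pi ht.1 (by linarith [ht.2])
    simp only [hA, hB, hl]
    rw [Real.tan_eq_sin_div_cos, Real.log_div hs.ne' hc.ne', Real.log_mul two_ne_zero hs.ne',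
      Real.log_mul two_ne_zero hc.ne']
    ring
  have hdouble : ∀ t ∈ Ioo 0 (Real.pi / 4), B (2 * t) = l t + 2 * A t := fun t ht => by
    have hc := cos_pos_of_mem_Icc (Ioo_subset_Icc_self ht)
    have hs := Real.sin_pos_of_pos_of_lt_pi ht.1 (by linarith [ht.2])
    rw [two_mul (A t), ← add_assoc, ← hBA t ht]
    simp only [hA, hB]
    rw [Real.sin_two_mul, ← Real.log_mul (by positivity) (by positivity)]
    congr 1
    ring
  have iA : IntervalIntegrable (fun t => A t ^ 2) volume 0 (Real.pi / 4) :=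
    ContinuousOn.intervalIntegrable_of_Icc pi_div_four_pos.le (continuousOn_log_two_mul_cos.pow 2)
  have iAl : IntervalIntegrable (fun t => A t * l t) volume 0 (Real.pi / 4) :=
    intervalIntegrable_log_tan.continuousOn_mul
      (by rw [uIcc_of_le pi_div_four_pos.le]; exact continuousOn_log_two_mul_cos)
  have il : IntervalIntegrable (fun t => l t ^ 2) volume 0 (Real.pi / 4) :=
    intervalIntegrable_log_tan_sq
  have comb (a b c : ℝ) : ∫ t in 0..Real.pi / 4, (a * A t ^ 2 + b * (A t * l t) + c * l t ^ 2) =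
      a * (∫ t in 0..Real.pi / 4, A t ^ 2) + b * (∫ t in 0..Real.pi / 4, A t * l t) +
        c * (Real.pi ^ 3 / 16) := by
    rw [intervalIntegral.integral_add ((iA.const_mul a).add (iAl.const_mul b)) (il.const_mul c),
      intervalIntegral.integral_add (iA.const_mul a) (iAl.const_mul b),
      intervalIntegral.integral_const_mul, intervalIntegral.integral_const_mul,
      intervalIntegral.integral_const_mul, integral_log_tan_sq]
  have congrIoo {f g : ℝ → ℝ} (h : ∀ t ∈ Ioo 0 (Real.pi / 4), f t = g t) :
      ∫ t in 0..Real.pi / 4, f t = ∫ t in 0..Real.pi / 4, g t := by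
    rw [intervalIntegral.integral_of_le pi_div_four_pos.le,
      intervalIntegral.integral_of_le pi_div_four_pos.le, integral_Ioc_eq_integral_Ioo,
      integral_Ioc_eq_integral_Ioo]
    exact setIntegral_congr_fun measurableSet_Ioo h
  have e1 : ∫ t in 0..Real.pi / 4, B t ^ 2 = (∫ t in 0..Real.pi / 4, A t ^ 2) +
      2 * (∫ t in 0..Real.pi / 4, A t * l t) + Real.pi ^ 3 / 16 := by
    rw [congrIoo (g := fun t => 1 * A t ^ 2 + 2 * (A t * l t) + 1 * l t ^ 2)
      fun t ht => by rw [hBA t ht]; ring, comb]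
    ring
  have e2 : ∫ t in 0..Real.pi / 4, B (2 * t) ^ 2 = 4 * (∫ t in 0..Real.pi / 4, A t ^ 2) +
      4 * (∫ t in 0..Real.pi / 4, A t * l t) + Real.pi ^ 3 / 16 := by
    rw [congrIoo (g := fun t => 4 * A t ^ 2 + 4 * (A t * l t) + 1 * l t ^ 2)
      fun t ht => by rw [hdouble t ht]; ring, comb]
    ring
  -- Rescaling gives an integral over `[0, π/2]`; its half beyond `π/4` reflects, sine into cosine,
  -- onto the integral of `A²`.
  have e3 : ∫ t in 0..Real.pi / 4, B (2 * t) ^ 2 = 1 / 2 * ∫ t in 0..Real.pi / 2, B t ^ 2 := by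
    rw [intervalIntegral.integral_comp_mul_left (fun t => B t ^ 2) two_ne_zero, smul_eq_mul]
    congr 2 <;> ring
  have e4 : ∫ t in Real.pi / 4..Real.pi / 2, B t ^ 2 = ∫ t in 0..Real.pi / 4, A t ^ 2 := by
    have h := intervalIntegral.integral_comp_sub_left (a := 0) (b := Real.pi / 4)
      (fun t => B t ^ 2) (Real.pi / 2)
    rw [show Real.pi / 2 - Real.pi / 4 = Real.pi / 4 by ring, sub_zero] at h
    rw [← h]
    simp only [hA, hB, Real.sin_pi_div_two_sub]
  have iB1 : IntervalIntegrable (fun t => B t ^ 2) volume 0 (Real.pi / 4) := by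
    rw [intervalIntegrable_iff_integrableOn_Ioo_of_le pi_div_four_pos.le]
    have := (iA.add (iAl.const_mul 2)).add il
    rw [intervalIntegrable_iff_integrableOn_Ioo_of_le pi_div_four_pos.le] at this
    refine this.congr_fun (fun t ht => ?_) measurableSet_Ioo
    simp only [hBA t ht]
    ring
  have iB2 : IntervalIntegrable (fun t => B t ^ 2) volume (Real.pi / 4) (Real.pi / 2) := by
    refine ContinuousOn.intervalIntegrable_of_Icc (by linarith) (ContinuousOn.pow ?_ 2)
    refine ContinuousOn.log (by fun_prop) fun t ht => ?_
    have := Real.sin_pos_of_pos_of_lt_pi (x := t) (by linarith [ht.1]) (by linarith [ht.2])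
    positivity
  have e5 := intervalIntegral.integral_add_adjacent_intervals iB1 iB2
  rw [e1, e4] at e5
  rw [e2, ← e5] at e3
  -- With `P = ∫ A²` and `Q = ∫ A l`, the relation reads `4P + 4Q + π³/16 = ½ (2P + 2Q + π³/16)`.
  linear_combination 1 / 3 * e3

/-- `∫ (log tan t) (t tan t)` over `[0, π/4]`. -/
lemma integral_log_tan_mul_mul_tan :
    ∫ t in 0..Real.pi / 4, Real.log (Real.tan t) * (t * Real.tan t) =
      (3 * Real.pi ^ 3 + 6 * Real.pi * Real.log 2 ^ 2 - 192 * W3) / 96 := by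
  have hpi := Real.pi_pos
  have hlc : ContinuousOn (fun t => Real.log (Real.cos t)) (Icc 0 (Real.pi / 4)) :=
    ContinuousOn.log (by fun_prop) fun t ht => (cos_pos_of_mem_Icc ht).ne'
  have hc1 : ContinuousOn (fun t => t * Real.tan t) (Icc 0 (Real.pi / 4)) :=
    continuousOn_id.mul continuousOn_tan_Icc
  have i1 : IntervalIntegrable (fun t => Real.log (Real.tan t) * (t * Real.tan t)) volume
      0 (Real.pi / 4) :=
    intervalIntegrable_log_tan.mul_continuousOn (by rwa [uIcc_of_le pi_div_four_pos.le])
  have i2 : IntervalIntegrable (fun t => Real.log (Real.tan t) * Real.log (Real.cos t)) volume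
      0 (Real.pi / 4) :=
    intervalIntegrable_log_tan.mul_continuousOn (by rwa [uIcc_of_le pi_div_four_pos.le])
  have hmem : ∀ t ∈ Icc 0 (Real.pi / 4), (-Real.tan t : ℂ) * I ∈ landenDomain := fun t ht => by
    have hx := tan_mem_Icc ht
    refine ⟨mem_bigDisc ?_ ?_, by simp⟩
    · rw [norm_mul, norm_neg, norm_I, mul_one, norm_real, Real.norm_of_nonneg hx.1]
      exact hx.2
    · intro h
      simpa using congrArg re h
  have hcontT : ContinuousOn (fun t : ℝ => 2 * (trilogPrimitive ((-Real.tan t : ℂ) * I)).im)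
      (Icc 0 (Real.pi / 4)) := by
    refine continuousOn_const.mul (continuous_im.comp_continuousOn fun t ht => ?_)
    refine (continuousAt_trilogPrimitive (hmem t ht)).comp_continuousWithinAt
      (f := fun t : ℝ => (-Real.tan t : ℂ) * I) ?_
    have := continuous_ofReal.continuousAt.comp_continuousWithinAt (continuousOn_tan_Icc t ht)
    simpa [Function.comp_def] using this.neg.mul_const I
  have hcont1 : ContinuousOn (fun t : ℝ => t * Real.log (Real.tan t)) (Icc 0 (Real.pi / 4)) := by
    refine continuousOn_Icc_of_bound (by simp)
      (fun t ht => (continuousAt_id.mul (continuousAt_log_tan ht)).continuousWithinAt)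
      (by simpa using tendsto_log_tan_mul_tan.abs) fun t ht => ?_
    rw [abs_mul, mul_comm, abs_of_pos ht.1, abs_of_pos (tan_mem_Ioo ht).1]
    gcongr
    exact Real.le_tan ht.1.le (by linarith [ht.1, ht.2, Real.pi_pos])
  -- Differentiating `log cos t · t · log tan t` gives the wanted integrand, `log tan · log cos`,
  -- and an unwanted `t log cos t / (sin t cos t)`. The last is cancelled by `trilogPrimitive` along
  -- `z = -i tan t`, where `log (1 - z) = -log cos t + i t`.
  have hcont : ContinuousOn (fun t : ℝ => -2 * (Real.log (Real.cos t) *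
      (t * Real.log (Real.tan t))) - 2 * (trilogPrimitive ((-Real.tan t : ℂ) * I)).im)
      (Icc 0 (Real.pi / 4)) :=
    (continuousOn_const.mul (hlc.mul hcont1)).sub hcontT
  have h := intervalIntegral.integral_eq_sub_of_hasDerivAt_of_le pi_div_four_pos.le hcont
    (f' := fun t => 2 * (Real.log (Real.tan t) * (t * Real.tan t)) +
      -2 * (Real.log (Real.tan t) * Real.log (Real.cos t))) (fun t ht => ?_)
    ((i1.const_mul 2).add (i2.const_mul (-2)))
  · rw [intervalIntegral.integral_add (i1.const_mul 2) (i2.const_mul (-2)),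
      intervalIntegral.integral_const_mul, intervalIntegral.integral_const_mul] at h
    have hQ : ∫ t in 0..Real.pi / 4, Real.log (Real.tan t) * Real.log (Real.cos t) =
        (∫ t in 0..Real.pi / 4, Real.log (2 * Real.cos t) * Real.log (Real.tan t)) -
          Real.log 2 * ∫ t in 0..Real.pi / 4, Real.log (Real.tan t) := by
      rw [← intervalIntegral.integral_const_mul, ← intervalIntegral.integral_sub
        (intervalIntegrable_log_tan.continuousOn_mul
          (by rw [uIcc_of_le pi_div_four_pos.le]; exact continuousOn_log_two_mul_cos))
        (intervalIntegrable_log_tan.const_mul _)]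
      refine intervalIntegral.integral_congr fun t ht => ?_
      rw [uIcc_of_le pi_div_four_pos.le] at ht
      rw [Real.log_mul two_ne_zero (cos_pos_of_mem_Icc ht).ne']
      ring
    have e1 : trilogPrimitive ((-Real.tan (0 : ℝ) : ℂ) * I) = 0 := by
      simp [trilogPrimitive_zero]
    have e2 : trilogPrimitive ((-Real.tan (Real.pi / 4) : ℂ) * I) = trilogPrimitive (-I) := by
      rw [Real.tan_pi_div_four]; simp
    rw [hQ, integral_log_two_mul_cos_mul_log_tan, integral_log_two_mul_cos_sq, integral_log_tan,
      e1, e2, trilogPrimitive_neg_I_im, Real.tan_pi_div_four, Real.log_one, zero_im] at h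
    -- Both paths end at `-i`, so its value enters twice in all; the `G log 2` terms cancel.
    linear_combination 1 / 2 * h
  · have hx := tan_mem_Ioo ht
    have hc := cos_pos_of_mem_Icc (Ioo_subset_Icc_self ht)
    have htan := Real.hasDerivAt_tan hc.ne'
    have hz : HasDerivAt (fun t : ℝ => (-Real.tan t : ℂ) * I)
        (-((1 / Real.cos t ^ 2 : ℝ) : ℂ) * I) t := htan.ofReal_comp.fun_neg.mul_const I
    have h0 : (-Real.tan t : ℂ) * I ≠ 0 :=
      mul_ne_zero (neg_ne_zero.2 (by exact_mod_cast hx.1.ne')) I_ne_zero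
    have dT := imCLM.hasFDerivAt.comp_hasDerivAt t ((hasDerivAt_trilogPrimitive
      (hmem t (Ioo_subset_Icc_self ht)) h0).comp t hz)
    have dlc := (Real.hasDerivAt_cos t).log hc.ne'
    refine (((dlc.mul ((hasDerivAt_id' t).mul (hasDerivAt_log_tan ht))).const_mul (-2)).sub
      (dT.const_mul 2)).congr_deriv ?_
    have hker (a x : ℝ) (L : ℂ) (hx : x ≠ 0) : (L ^ 2 / (2 * ((-x : ℂ) * I)) * (-(a : ℂ) * I)).im =
        a / x / 2 * (L ^ 2).im := by
      have hx' : (x : ℂ) ≠ 0 := by exact_mod_cast hx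
      rw [← im_ofReal_mul]
      congr 1
      push_cast
      have := I_ne_zero
      field_simp
    have him : ((((-Real.log (Real.cos t) : ℝ) : ℂ) + (t : ℂ) * I) ^ 2).im =
        -2 * Real.log (Real.cos t) * t := by
      rw [sq, mul_im]
      simp only [add_re, add_im, ofReal_re, ofReal_im, re_ofReal_mul, im_ofReal_mul, I_re, I_im]
      ring
    rw [imCLM_apply, hker _ _ _ hx.1.ne',
      show 1 - (-Real.tan t : ℂ) * I = 1 + Real.tan t * I by ring,
      log_one_add_tan_mul_I (Ioo_subset_Icc_self ht), him, Pi.mul_apply]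
    have hs : Real.sin t = Real.tan t * Real.cos t := (Real.tan_mul_cos hc.ne').symm
    rw [hs]
    have := hx.1
    field_simp
    ring

end ArctanLogSums

/-! ### Polygamma differences as moments of `1 / (1 + x²)`. -/

namespace ArctanLogSums
open Set Filter Topology MeasureTheory

lemma neg_nat_ne_of_pos {x : ℝ} (hx : 0 < x) (m : ℕ) : (x : ℂ) ≠ -m := by
  intro h
  have h1 : x = -m := by exact_mod_cast h
  have : (0 : ℝ) ≤ m := m.cast_nonneg
  linarith

lemma differentiableAt_digamma {x : ℝ} (hx : 0 < x) :
    DifferentiableAt ℂ Complex.digamma (x : ℂ) := by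
  have hopen : IsOpen {z : ℂ | 0 < z.re} := isOpen_lt continuous_const Complex.continuous_re
  have hd : DifferentiableOn ℂ Complex.Gamma {z : ℂ | 0 < z.re} := fun z hz =>
    (Complex.differentiableAt_Gamma z fun m h => by
      have h1 : z.re = -m := by rw [h]; simp
      have h2 : (0 : ℝ) ≤ m := m.cast_nonneg
      have h3 : 0 < z.re := hz
      linarith).differentiableWithinAt
  have hx' : (x : ℂ) ∈ {z : ℂ | 0 < z.re} := by simpa using hx
  have han : AnalyticAt ℂ Complex.Gamma x := hd.analyticAt (hopen.mem_nhds hx')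
  rw [Complex.digamma_def]
  exact han.deriv.differentiableAt.div han.differentiableAt
    (Complex.Gamma_ne_zero_of_re_pos (by simpa using hx))

lemma polygamma_zero (x : ℝ) : polygamma 0 x = (Complex.digamma x).re := by
  simp [polygamma]

lemma hasDerivAt_polygamma_zero {x : ℝ} (hx : 0 < x) :
    HasDerivAt (polygamma 0) (polygamma 1 x) x := by
  have h := (differentiableAt_digamma hx).hasDerivAt.real_of_complex
  rw [← iteratedDeriv_one] at h
  exact h.congr_of_eventuallyEq (Eventually.of_forall fun y => polygamma_zero y)

lemma hasDerivAt_log_Gamma {x : ℝ} (hx : 0 < x) :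
    HasDerivAt (Real.log ∘ Real.Gamma) (polygamma 0 x) x := by
  have h := (Complex.differentiableAt_Gamma x (neg_nat_ne_of_pos hx)).hasDerivAt.real_of_complex
  have h2 : HasDerivAt Real.Gamma (deriv Complex.Gamma x).re x :=
    h.congr_of_eventuallyEq (Eventually.of_forall fun y => rfl)
  refine (h2.log (Real.Gamma_pos_of_pos hx).ne').congr_deriv ?_
  rw [polygamma_zero, Complex.digamma_def, logDeriv_apply, Complex.Gamma_ofReal,
    Complex.div_ofReal_re]

/-- `ψ` is the derivative of the convex function `log Γ`. -/
lemma monotoneOn_polygamma_zero : MonotoneOn (polygamma 0) (Ioi 0) := by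
  have h := Real.convexOn_log_Gamma.monotoneOn_deriv
    fun x hx => (hasDerivAt_log_Gamma hx).differentiableAt
  intro x hx y hy hxy
  have := h hx hy hxy
  rwa [(hasDerivAt_log_Gamma hx).deriv, (hasDerivAt_log_Gamma hy).deriv] at this

lemma polygamma_zero_add_one {x : ℝ} (hx : 0 < x) :
    polygamma 0 (x + 1) = polygamma 0 x + 1 / x := by
  rw [polygamma_zero, polygamma_zero]
  push_cast
  rw [Complex.digamma_apply_add_one _ (neg_nat_ne_of_pos hx), Complex.add_re, ← Complex.ofReal_inv,
    Complex.ofReal_re, one_div]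

lemma polygamma_one_add_one {x : ℝ} (hx : 0 < x) :
    polygamma 1 (x + 1) = polygamma 1 x - 1 / x ^ 2 := by
  have h1 : HasDerivAt (fun x => polygamma 0 (x + 1)) (polygamma 1 (x + 1)) x :=
    (hasDerivAt_polygamma_zero (by linarith : 0 < x + 1)).comp_add_const x 1
  have h2 : HasDerivAt (fun x => polygamma 0 x + 1 / x) (polygamma 1 x - 1 / x ^ 2) x := by
    refine ((hasDerivAt_polygamma_zero hx).fun_add
      ((hasDerivAt_const x (1 : ℝ)).fun_div (hasDerivAt_id' x) hx.ne')).congr_deriv ?_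
    ring
  refine h1.unique (h2.congr_of_eventuallyEq ?_)
  filter_upwards [eventually_gt_nhds hx] with y hy using polygamma_zero_add_one hy

lemma polygamma_zero_add_nat {x : ℝ} (hx : 0 < x) (n : ℕ) :
    polygamma 0 (x + n) = polygamma 0 x + ∑ i ∈ Finset.range n, 1 / (x + i) := by
  induction n with
  | zero => simp
  | succ n ih =>
    rw [Finset.sum_range_succ, ← add_assoc, ← ih, ← polygamma_zero_add_one (by positivity)]
    push_cast
    ring_nf

lemma polygamma_one_add_nat {x : ℝ} (hx : 0 < x) (n : ℕ) :
    polygamma 1 (x + n) = polygamma 1 x - ∑ i ∈ Finset.range n, 1 / (x + i) ^ 2 := by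
  induction n with
  | zero => simp
  | succ n ih =>
    rw [Finset.sum_range_succ, ← sub_sub, ← ih, ← polygamma_one_add_one (by positivity)]
    push_cast
    ring_nf

/-- By the functional equation the partial sums miss the limit by `ψ(1 + n) - ψ(x + n)`, which
monotonicity traps between 0 and `1 / (x + n)`. -/
lemma hasSum_polygamma_zero {x : ℝ} (h0 : 0 < x) (h1 : x < 1) :
    HasSum (fun i : ℕ => 1 / (x + i) - 1 / (1 + (i : ℝ))) (polygamma 0 1 - polygamma 0 x) := by
  rw [hasSum_iff_tendsto_nat_of_nonneg]
  · have hlim : Tendsto (fun n : ℕ => polygamma 0 (1 + n) - polygamma 0 (x + n)) atTop (𝓝 0) := by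
      refine squeeze_zero (fun n => ?_) (fun n => ?_) ?_ (g := fun n : ℕ => 1 / (x + n))
      · rw [sub_nonneg]
        exact monotoneOn_polygamma_zero (by simp; positivity) (by simp; positivity) (by linarith)
      · rw [sub_le_iff_le_add', ← polygamma_zero_add_one (by positivity)]
        exact monotoneOn_polygamma_zero (by simp; positivity) (by simp; positivity) (by linarith)
      · simp only [one_div]
        exact tendsto_inv_atTop_zero.comp (tendsto_atTop_add_const_left _ _
          tendsto_natCast_atTop_atTop)
    have := hlim.const_sub (polygamma 0 1 - polygamma 0 x)
    rw [sub_zero] at this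
    refine this.congr fun n => ?_
    rw [polygamma_zero_add_nat h0, polygamma_zero_add_nat one_pos, Finset.sum_sub_distrib]
    ring
  · intro i
    rw [sub_nonneg]
    gcongr

/-- The previous series is differentiated termwise on `(x/2, 1)`, where `1 / (x/2 + i)²` dominates
the derivatives. -/
lemma hasSum_polygamma_one {x : ℝ} (h0 : 0 < x) (h1 : x < 1) :
    HasSum (fun i : ℕ => 1 / (x + i) ^ 2) (polygamma 1 x) := by
  have hsum {a : ℝ} (ha : 0 < a) : Summable fun i : ℕ => 1 / (a + i) ^ 2 := by
    refine ((Real.summable_one_div_nat_add_rpow a 2).2 (by norm_num)).congr fun i => ?_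
    rw [abs_of_pos (by positivity), add_comm]
    norm_num
  have hd : HasDerivAt (fun y => ∑' i : ℕ, (1 / (y + i) - 1 / (1 + (i : ℝ))))
      (∑' i : ℕ, -(1 / (x + i) ^ 2)) x := by
    refine hasDerivAt_tsum_of_isPreconnected (t := Ioo (x / 2) 1) (y₀ := x)
      (g := fun (i : ℕ) y => 1 / (y + i) - 1 / (1 + (i : ℝ)))
      (g' := fun (i : ℕ) y => -(1 / (y + i) ^ 2)) (hsum (half_pos h0)) isOpen_Ioo
      isPreconnected_Ioo (fun i y hy => ?_) (fun i y hy => ?_) ⟨by linarith, h1⟩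
      (hasSum_polygamma_zero h0 h1).summable ⟨by linarith, h1⟩
    · have hy0 : 0 < y + i := add_pos_of_pos_of_nonneg (by linarith [hy.1]) i.cast_nonneg
      refine (((hasDerivAt_const y (1 : ℝ)).fun_div ((hasDerivAt_id' y).add_const (i : ℝ))
        hy0.ne').sub_const _).congr_deriv ?_
      ring
    · have := hy.1
      rw [norm_neg, Real.norm_of_nonneg (by positivity)]
      gcongr
  have h2 := hd.const_sub (polygamma 0 1)
  have h3 : HasDerivAt (polygamma 0) (-∑' i : ℕ, -(1 / (x + i) ^ 2)) x := by
    refine h2.congr_of_eventuallyEq ?_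
    filter_upwards [Ioo_mem_nhds h0 h1] with y hy
    rw [(hasSum_polygamma_zero hy.1 hy.2).tsum_eq]
    ring
  rw [(hasDerivAt_polygamma_zero h0).unique h3, tsum_neg, neg_neg]
  exact (hsum h0).hasSum

lemma tendsto_polygamma_one_add_nat {x : ℝ} (h0 : 0 < x) (h1 : x < 1) :
    Tendsto (fun n : ℕ => polygamma 1 (x + n)) atTop (𝓝 0) := by
  have := (hasSum_polygamma_one h0 h1).tendsto_sum_nat.const_sub (polygamma 1 x)
  rw [sub_self] at this
  exact this.congr fun n => (polygamma_one_add_nat h0 n).symm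

/-- Integration by parts against `x ^ n * log x`. -/
lemma integral_log_mul_pow_mul (n : ℕ) {g g' : ℝ → ℝ} (hg : ∀ x, HasDerivAt g (g' x) x)
    (hg' : Continuous g') :
    ∫ x in 0..1, Real.log x * (x ^ n * g x) = -g 1 / (n + 1) ^ 2 -
      (∫ x in 0..1, Real.log x * (x ^ (n + 1) * g' x)) / (n + 1) +
      (∫ x in 0..1, x ^ (n + 1) * g' x) / (n + 1) ^ 2 := by
  have hgc : Continuous g := continuous_iff_continuousAt.2 fun x => (hg x).continuousAt
  have hn : ((n : ℝ) + 1) ≠ 0 := by positivity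
  have i1 : IntervalIntegrable (fun x => Real.log x * (x ^ n * g x)) volume 0 1 :=
    intervalIntegral.intervalIntegrable_log'.mul_continuousOn (by fun_prop)
  have i2 : IntervalIntegrable (fun x => Real.log x * (x ^ (n + 1) * g' x)) volume 0 1 :=
    intervalIntegral.intervalIntegrable_log'.mul_continuousOn (by fun_prop)
  have i3 : IntervalIntegrable (fun x => x ^ (n + 1) * g' x) volume 0 1 :=
    Continuous.intervalIntegrable (by fun_prop) _ _
  -- The first factor is the primitive of `x^n log x`, written through `x log x` so that continuity
  -- at 0 is available.
  have hcont : Continuous fun x : ℝ => (x ^ n * (x * Real.log x) / (n + 1) -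
      x ^ (n + 1) / (n + 1) ^ 2) * g x := by
    have := Real.continuous_mul_log
    fun_prop
  have h := intervalIntegral.integral_eq_sub_of_hasDerivAt_of_le zero_le_one hcont.continuousOn
    (f' := fun x => Real.log x * (x ^ n * g x) + (Real.log x * (x ^ (n + 1) * g' x) / (n + 1) -
      x ^ (n + 1) * g' x / (n + 1) ^ 2)) (fun x hx => ?_)
    (i1.add ((i2.div_const _).sub (i3.div_const _)))
  · rw [intervalIntegral.integral_add i1 ((i2.div_const _).sub (i3.div_const _)),
      intervalIntegral.integral_sub (i2.div_const _) (i3.div_const _),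
      intervalIntegral.integral_div, intervalIntegral.integral_div] at h
    simp at h
    linear_combination h
  · have d := ((((hasDerivAt_pow n x).fun_mul (Real.hasDerivAt_mul_log hx.1.ne')).div_const
      ((n : ℝ) + 1)).sub ((hasDerivAt_pow (n + 1) x).div_const (((n : ℝ) + 1) ^ 2))).mul (hg x)
    refine d.congr_deriv ?_
    have hnx : (n : ℝ) * x ^ (n - 1) * x = n * x ^ n := by
      cases n with
      | zero => simp
      | succ n => rw [Nat.add_sub_cancel, mul_assoc, ← pow_succ]
    simp only [Nat.add_sub_cancel, Pi.sub_apply, ← mul_assoc, hnx]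
    push_cast
    field_simp
    ring

/-- Integration by parts against `x ^ n`. -/
lemma integral_pow_mul (n : ℕ) {g g' : ℝ → ℝ} (hg : ∀ x, HasDerivAt g (g' x) x)
    (hg' : Continuous g') :
    ∫ x in 0..1, x ^ n * g x = g 1 / (n + 1) - (∫ x in 0..1, x ^ (n + 1) * g' x) / (n + 1) := by
  have hgc : Continuous g := continuous_iff_continuousAt.2 fun x => (hg x).continuousAt
  have hn : ((n : ℝ) + 1) ≠ 0 := by positivity
  have i1 : IntervalIntegrable (fun x => x ^ n * g x) volume 0 1 :=
    Continuous.intervalIntegrable (by fun_prop) _ _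
  have i3 : IntervalIntegrable (fun x => x ^ (n + 1) * g' x) volume 0 1 :=
    Continuous.intervalIntegrable (by fun_prop) _ _
  have h := intervalIntegral.integral_eq_sub_of_hasDerivAt (a := 0) (b := 1)
    (f := fun x => x ^ (n + 1) / (n + 1) * g x)
    (f' := fun x => x ^ n * g x + x ^ (n + 1) * g' x / (n + 1)) (fun x _ => ?_)
    (i1.add (i3.div_const _))
  · rw [intervalIntegral.integral_add i1 (i3.div_const _), intervalIntegral.integral_div] at h
    simp at h
    linear_combination h
  · refine (((hasDerivAt_pow (n + 1) x).div_const ((n : ℝ) + 1)).mul (hg x)).congr_deriv ?_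
    simp only [Nat.add_sub_cancel]
    push_cast
    field_simp

lemma integral_log_mul_pow (n : ℕ) :
    ∫ x in 0..1, Real.log x * x ^ n = -1 / ((n : ℝ) + 1) ^ 2 := by
  have := integral_log_mul_pow_mul n (g := fun _ => 1) (g' := fun _ => 0)
    (fun x => hasDerivAt_const x 1) continuous_const
  simpa using this

/-- A sequence that changes sign at each step and has a subsequence tending to `0` vanishes. -/
lemma eq_zero_of_alternating {a : ℕ → ℝ} (h : ∀ m, a (m + 1) = -a m)
    (hlim : Tendsto (fun n => a (2 * n)) atTop (𝓝 0)) (m : ℕ) : a m = 0 := by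
  have h1 : ∀ m, a m = (-1) ^ m * a 0 := fun m => by
    induction m with
    | zero => simp
    | succ m ih => rw [h, ih, pow_succ]; ring
  have h0 : a 0 = 0 := by
    refine tendsto_nhds_unique (tendsto_const_nhds.congr fun n => ?_) hlim
    rw [h1 (2 * n), pow_mul]
    simp
  rw [h1, h0, mul_zero]

lemma continuous_inv_one_add_sq : Continuous fun x : ℝ => 1 / (1 + x ^ 2) :=
  continuous_const.div (by fun_prop) fun x => by positivity

/-- `x^(m+2) + x^m = x^m (1 + x²)` cancels the denominator. -/
lemma integral_log_mul_add (m : ℕ) {g : ℝ → ℝ} (hg : Continuous g) :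
    (∫ x in 0..1, Real.log x * (x ^ (m + 2) * (g x * (1 / (1 + x ^ 2))))) +
      (∫ x in 0..1, Real.log x * (x ^ m * (g x * (1 / (1 + x ^ 2))))) =
    ∫ x in 0..1, Real.log x * (x ^ m * g x) := by
  have hc := continuous_inv_one_add_sq
  have i (m : ℕ) : IntervalIntegrable (fun x => Real.log x * (x ^ m * (g x * (1 / (1 + x ^ 2)))))
      volume 0 1 :=
    intervalIntegral.intervalIntegrable_log'.mul_continuousOn (by fun_prop)
  rw [← intervalIntegral.integral_add (i _) (i _)]
  refine intervalIntegral.integral_congr fun x _ => ?_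
  have : 1 + x ^ 2 ≠ 0 := by positivity
  field_simp
  ring

lemma integral_add_shift (m : ℕ) {g : ℝ → ℝ} (hg : Continuous g) :
    (∫ x in 0..1, x ^ (m + 2) * (g x * (1 / (1 + x ^ 2)))) +
      (∫ x in 0..1, x ^ m * (g x * (1 / (1 + x ^ 2)))) = ∫ x in 0..1, x ^ m * g x := by
  have hc := continuous_inv_one_add_sq
  have i (m : ℕ) : IntervalIntegrable (fun x => x ^ m * (g x * (1 / (1 + x ^ 2)))) volume 0 1 :=
    Continuous.intervalIntegrable (by fun_prop) _ _
  rw [← intervalIntegral.integral_add (i _) (i _)]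
  refine intervalIntegral.integral_congr fun x _ => ?_
  have : 1 + x ^ 2 ≠ 0 := by positivity
  field_simp
  ring

lemma integral_pow_div_add (m : ℕ) :
    (∫ x in 0..1, x ^ (m + 2) * (1 / (1 + x ^ 2))) + (∫ x in 0..1, x ^ m * (1 / (1 + x ^ 2))) =
      1 / ((m : ℝ) + 1) := by
  have := integral_add_shift m (g := fun _ => 1) continuous_const
  simpa using this

lemma integral_log_mul_pow_div_add (m : ℕ) :
    (∫ x in 0..1, Real.log x * (x ^ (m + 2) * (1 / (1 + x ^ 2)))) +
      (∫ x in 0..1, Real.log x * (x ^ m * (1 / (1 + x ^ 2)))) = -1 / ((m : ℝ) + 1) ^ 2 := by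
  have := integral_log_mul_add m (g := fun _ => 1) continuous_const
  simp only [one_mul, mul_one] at this
  rw [this, integral_log_mul_pow]

lemma integral_pow_div_nonneg (m : ℕ) : 0 ≤ ∫ x in 0..1, x ^ m * (1 / (1 + x ^ 2)) :=
  intervalIntegral.integral_nonneg zero_le_one fun x hx => by have := hx.1; positivity

lemma integral_log_mul_pow_div_nonpos (m : ℕ) :
    ∫ x in 0..1, Real.log x * (x ^ m * (1 / (1 + x ^ 2))) ≤ 0 := by
  rw [← neg_nonneg, ← intervalIntegral.integral_neg]
  refine intervalIntegral.integral_nonneg zero_le_one fun x hx => ?_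
  rw [← neg_mul]
  have h1 := hx.1
  have := Real.log_nonpos hx.1 hx.2
  have : 0 ≤ -Real.log x := by linarith
  positivity

lemma tendsto_one_div_two_mul_add_one :
    Tendsto (fun n : ℕ => 1 / (((2 * (2 * n) : ℕ) : ℝ) + 1)) atTop (𝓝 0) := by
  refine squeeze_zero (fun n => by positivity) (fun n => ?_) tendsto_one_div_add_atTop_nhds_zero_nat
  push_cast
  gcongr
  linarith [(n.cast_nonneg : (0 : ℝ) ≤ n)]

/-- `ψ((2m+3)/4) - ψ((2m+1)/4)` as an integral. -/
lemma polygamma_zero_sub (m : ℕ) :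
    polygamma 0 ((2 * (m : ℝ) + 3) / 4) - polygamma 0 ((2 * (m : ℝ) + 1) / 4) =
      4 * ∫ x in 0..1, x ^ (2 * m) * (1 / (1 + x ^ 2)) := by
  have key := eq_zero_of_alternating (a := fun m : ℕ => polygamma 0 ((2 * (m : ℝ) + 3) / 4) -
    polygamma 0 ((2 * (m : ℝ) + 1) / 4) - 4 * ∫ x in 0..1, x ^ (2 * m) * (1 / (1 + x ^ 2)))
    (fun m => ?_) ?_ m
  · linarith
  · have h1 := polygamma_zero_add_one (x := (2 * (m : ℝ) + 1) / 4) (by positivity)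
    have h2 := integral_pow_div_add (2 * m)
    simp only [mul_add, mul_one]
    push_cast at h2 ⊢
    rw [show (2 * ((m : ℝ) + 1) + 3) / 4 = (2 * m + 1) / 4 + 1 by ring,
      show (2 * ((m : ℝ) + 1) + 1) / 4 = (2 * m + 3) / 4 by ring, h1]
    have : (2 * (m : ℝ) + 1) ≠ 0 := by positivity
    have h3 : 1 / ((2 * (m : ℝ) + 1) / 4) = 4 * (1 / (2 * (m : ℝ) + 1)) := by field_simp
    rw [h3, ← h2]
    ring
  · have l1 : Tendsto (fun n : ℕ => polygamma 0 ((2 * ((2 * n : ℕ) : ℝ) + 3) / 4) -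
        polygamma 0 ((2 * ((2 * n : ℕ) : ℝ) + 1) / 4)) atTop (𝓝 0) := by
      refine squeeze_zero (fun n => ?_) (fun n => ?_)
        (by simpa using tendsto_one_div_two_mul_add_one.const_mul 4)
      · rw [sub_nonneg]
        exact monotoneOn_polygamma_zero (by simp; positivity) (by simp; positivity) (by linarith)
      · rw [sub_le_iff_le_add']
        have h1 := polygamma_zero_add_one (x := (2 * ((2 * n : ℕ) : ℝ) + 1) / 4) (by positivity)
        calc _ ≤ polygamma 0 ((2 * ((2 * n : ℕ) : ℝ) + 1) / 4 + 1) :=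
              monotoneOn_polygamma_zero (by simp; positivity) (by simp; positivity) (by linarith)
          _ = _ := by
            rw [h1]
            push_cast
            have : (2 * (2 * (n : ℝ)) + 1) ≠ 0 := by positivity
            field_simp
    have l2 : Tendsto (fun n : ℕ => ∫ x in 0..1, x ^ (2 * (2 * n)) * (1 / (1 + x ^ 2))) atTop
        (𝓝 (0 : ℝ)) := by
      refine squeeze_zero (fun n => integral_pow_div_nonneg _) (fun n => ?_)
        tendsto_one_div_two_mul_add_one
      rw [← integral_pow_div_add]
      linarith [integral_pow_div_nonneg (2 * (2 * n) + 2)]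
    simpa using l1.sub (l2.const_mul 4)

/-- `ψ'((2m+3)/4) - ψ'((2m+1)/4)` as an integral. -/
lemma polygamma_one_sub (m : ℕ) :
    polygamma 1 ((2 * (m : ℝ) + 3) / 4) - polygamma 1 ((2 * (m : ℝ) + 1) / 4) =
      16 * ∫ x in 0..1, Real.log x * (x ^ (2 * m) * (1 / (1 + x ^ 2))) := by
  have key := eq_zero_of_alternating (a := fun m : ℕ => polygamma 1 ((2 * (m : ℝ) + 3) / 4) -
    polygamma 1 ((2 * (m : ℝ) + 1) / 4) -
      16 * ∫ x in 0..1, Real.log x * (x ^ (2 * m) * (1 / (1 + x ^ 2))))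
    (fun m => ?_) ?_ m
  · linarith
  · have h1 := polygamma_one_add_one (x := (2 * (m : ℝ) + 1) / 4) (by positivity)
    have h2 := integral_log_mul_pow_div_add (2 * m)
    simp only [mul_add, mul_one]
    push_cast at h2 ⊢
    rw [show (2 * ((m : ℝ) + 1) + 3) / 4 = (2 * m + 1) / 4 + 1 by ring,
      show (2 * ((m : ℝ) + 1) + 1) / 4 = (2 * m + 3) / 4 by ring, h1]
    have : (2 * (m : ℝ) + 1) ≠ 0 := by positivity
    have h3 : 1 / ((2 * (m : ℝ) + 1) / 4) ^ 2 = -16 * (-1 / (2 * (m : ℝ) + 1) ^ 2) := by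
      field_simp; norm_num
    rw [h3, ← h2]
    ring
  -- For `m = 2n` the arguments are `3/4 + n` and `1/4 + n`, integer shifts of points of `(0, 1)`,
  -- where `ψ'` tends to 0 as the tail of its series.
  · have l1 : Tendsto (fun n : ℕ => polygamma 1 ((2 * ((2 * n : ℕ) : ℝ) + 3) / 4) -
        polygamma 1 ((2 * ((2 * n : ℕ) : ℝ) + 1) / 4)) atTop (𝓝 0) := by
      have := (tendsto_polygamma_one_add_nat (x := 3 / 4) (by norm_num) (by norm_num)).sub
        (tendsto_polygamma_one_add_nat (x := 1 / 4) (by norm_num) (by norm_num))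
      rw [sub_zero] at this
      refine this.congr fun n => ?_
      push_cast
      congr 2 <;> ring
    have l2 : Tendsto (fun n : ℕ => ∫ x in 0..1, Real.log x *
        (x ^ (2 * (2 * n)) * (1 / (1 + x ^ 2)))) atTop (𝓝 (0 : ℝ)) := by
      have l3 := (tendsto_one_div_two_mul_add_one.pow 2).neg
      simp only [ne_eq, OfNat.ofNat_ne_zero, not_false_eq_true, zero_pow, neg_zero] at l3
      refine tendsto_of_tendsto_of_tendsto_of_le_of_le l3 tendsto_const_nhds (fun n => ?_)
        fun n => integral_log_mul_pow_div_nonpos _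
      have h := integral_log_mul_pow_div_add (2 * (2 * n))
      have h4 := integral_log_mul_pow_div_nonpos (2 * (2 * n) + 2)
      simp only [one_div_pow]
      rw [neg_div] at h
      linarith
    simpa using l1.sub (l2.const_mul 16)

end ArctanLogSums

/-! ### Recurrences and closed forms for the arctangent moments. -/

namespace ArctanLogSums
open Set Filter Topology MeasureTheory

lemma eq_alternating_sum {a c : ℕ → ℝ} (h : ∀ m, a (m + 1) + a m = c m) (m : ℕ) :
    a m = ∑ j ∈ Finset.Icc 1 m, (-1) ^ (j + 1) * c (m - j) + (-1) ^ m * a 0 := by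
  have hshift (f : ℕ → ℝ) (m : ℕ) :
      ∑ j ∈ Finset.Icc 1 m, f j = ∑ j ∈ Finset.range m, f (j + 1) := by
    rw [Finset.range_eq_Ico, Finset.sum_Ico_add' f 0 m 1]
    rfl
  rw [hshift]
  induction m with
  | zero => simp
  | succ m ih =>
    rw [Finset.sum_range_succ', eq_sub_of_add_eq (h m), ih]
    simp only [Nat.add_sub_add_right, zero_add, pow_succ]
    have : ∑ k ∈ Finset.range m, (-1 : ℝ) ^ k * -1 * -1 * -1 * c (m - (k + 1)) =
        -∑ k ∈ Finset.range m, (-1 : ℝ) ^ k * -1 * -1 * c (m - (k + 1)) := by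
      rw [← Finset.sum_neg_distrib]
      exact Finset.sum_congr rfl fun _ _ => by ring
    rw [this, Nat.add_sub_cancel]
    ring

/-- No regularity of `g` is asked for, so singular integrands such as `log tan` are admissible. -/
lemma integral_comp_arctan (g : ℝ → ℝ) :
    ∫ x in 0..1, g (Real.arctan x) * (1 / (1 + x ^ 2)) = ∫ t in 0..Real.pi / 4, g t := by
  have himg : Real.arctan '' Ioo 0 1 = Ioo 0 (Real.pi / 4) := by
    ext t
    constructor
    · rintro ⟨x, hx, rfl⟩
      refine ⟨by rw [← Real.arctan_zero]; exact Real.arctan_strictMono hx.1, ?_⟩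
      rw [← Real.arctan_one]
      exact Real.arctan_strictMono hx.2
    · intro ht
      exact ⟨Real.tan t, tan_mem_Ioo ht, Real.arctan_tan (by linarith [ht.1, Real.pi_pos])
        (by linarith [ht.2, Real.pi_pos])⟩
  rw [intervalIntegral.integral_of_le pi_div_four_pos.le,
    intervalIntegral.integral_of_le zero_le_one, integral_Ioc_eq_integral_Ioo,
    integral_Ioc_eq_integral_Ioo, ← himg,
    integral_image_eq_integral_abs_deriv_smul measurableSet_Ioo
      (fun x _ => (Real.hasDerivAt_arctan x).hasDerivWithinAt) Real.arctan_injective.injOn]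
  refine setIntegral_congr_fun measurableSet_Ioo fun x _ => ?_
  have : 0 < 1 / (1 + x ^ 2) := by positivity
  simp only [smul_eq_mul, abs_of_pos this]
  ring

/-- `∫ x^(2m+1) arctan x / (1 + x²)` over the unit interval. -/
noncomputable def arctanMoment (m : ℕ) : ℝ :=
  ∫ x in 0..1, x ^ (2 * m + 1) * (Real.arctan x * (1 / (1 + x ^ 2)))

/-- `∫ x^(2m+1) log x arctan x / (1 + x²)` over the unit interval. -/
noncomputable def arctanLogMoment (m : ℕ) : ℝ :=
  ∫ x in 0..1, Real.log x * (x ^ (2 * m + 1) * (Real.arctan x * (1 / (1 + x ^ 2))))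

/-- `∫ x^(2k) log x arctan² x / (1 + x²)` over the unit interval. -/
noncomputable def arctanSqLogMoment (k : ℕ) : ℝ :=
  ∫ x in 0..1, Real.log x * (x ^ (2 * k) * (Real.arctan x ^ 2 * (1 / (1 + x ^ 2))))

lemma arctanMoment_zero : arctanMoment 0 = (4 * catalanG - Real.pi * Real.log 2) / 8 := by
  have h := integral_comp_arctan fun t => t * Real.tan t
  rw [integral_mul_tan] at h
  rw [arctanMoment, show (4 * catalanG - Real.pi * Real.log 2) / 8 =
    catalanG / 2 - Real.pi * Real.log 2 / 8 by ring, ← h]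
  refine intervalIntegral.integral_congr fun x _ => ?_
  simp only [Real.tan_arctan]
  ring

lemma arctanLogMoment_zero : arctanLogMoment 0 =
    (3 * Real.pi ^ 3 + 6 * Real.pi * Real.log 2 ^ 2 - 192 * W3) / 96 := by
  have h := integral_comp_arctan fun t => Real.log (Real.tan t) * (t * Real.tan t)
  rw [integral_log_tan_mul_mul_tan] at h
  rw [arctanLogMoment, ← h]
  refine intervalIntegral.integral_congr fun x _ => ?_
  simp only [Real.tan_arctan]
  ring

lemma arctanSqLogMoment_zero : arctanSqLogMoment 0 =
    -catalanG * Real.pi ^ 2 / 16 + dirichletBeta 4 / 2 := by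
  have h := integral_comp_arctan fun t => Real.log (Real.tan t) * t ^ 2
  rw [integral_log_tan_mul_sq] at h
  rw [arctanSqLogMoment, ← h]
  refine intervalIntegral.integral_congr fun x _ => ?_
  simp only [Real.tan_arctan]
  ring

/-- Once the denominator is cleared, integration by parts gives the boundary value `arctan 1 = π/4`
and the moment of `1 / (1 + x²)` of degree `2(m + 1)`, a digamma difference. -/
lemma arctanMoment_succ_add (m : ℕ) : arctanMoment (m + 1) + arctanMoment m =
    (Real.pi + polygamma 0 ((2 * ((m : ℝ) + 1) + 1) / 4) -
      polygamma 0 ((2 * ((m : ℝ) + 1) + 3) / 4)) / (8 * ((m : ℝ) + 1)) := by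
  have h := integral_add_shift (2 * m + 1) Real.continuous_arctan
  rw [integral_pow_mul (2 * m + 1) Real.hasDerivAt_arctan continuous_inv_one_add_sq,
    Real.arctan_one] at h
  have hp := polygamma_zero_sub (m + 1)
  have hm : (m : ℝ) + 1 ≠ 0 := by positivity
  rw [arctanMoment, arctanMoment, show 2 * (m + 1) + 1 = 2 * m + 1 + 2 by ring, h]
  rw [show 2 * (m + 1) = 2 * m + 1 + 1 by ring] at hp
  push_cast at hp ⊢
  rw [show (2 * (m : ℝ) + 1 + 1) = 2 * (m + 1) by ring]
  generalize ∫ x in 0..1, x ^ (2 * m + 1 + 1) * (1 / (1 + x ^ 2)) = J at hp ⊢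
  field_simp
  linear_combination 8 * hp

lemma arctanLogMoment_succ_add (m : ℕ) : arctanLogMoment (m + 1) + arctanLogMoment m =
    1 / (64 * ((m : ℝ) + 1) ^ 2) * (-4 * Real.pi + 4 * polygamma 0 ((2 * ((m : ℝ) + 1) + 3) / 4) -
      4 * polygamma 0 ((2 * ((m : ℝ) + 1) + 1) / 4) -
      2 * ((m : ℝ) + 1) * (polygamma 1 ((2 * ((m : ℝ) + 1) + 3) / 4) -
        polygamma 1 ((2 * ((m : ℝ) + 1) + 1) / 4))) := by
  have h := integral_log_mul_add (2 * m + 1) Real.continuous_arctan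
  rw [integral_log_mul_pow_mul (2 * m + 1) Real.hasDerivAt_arctan continuous_inv_one_add_sq,
    Real.arctan_one] at h
  have hp := polygamma_zero_sub (m + 1)
  have hp1 := polygamma_one_sub (m + 1)
  have hm : (m : ℝ) + 1 ≠ 0 := by positivity
  rw [arctanLogMoment, arctanLogMoment, show 2 * (m + 1) + 1 = 2 * m + 1 + 2 by ring, h]
  rw [show 2 * (m + 1) = 2 * m + 1 + 1 by ring] at hp hp1
  push_cast at hp hp1 ⊢
  rw [show (2 * (m : ℝ) + 1 + 1) = 2 * (m + 1) by ring, hp1]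
  generalize ∫ x in 0..1, x ^ (2 * m + 1 + 1) * (1 / (1 + x ^ 2)) = J at hp ⊢
  generalize ∫ x in 0..1, Real.log x * (x ^ (2 * m + 1 + 1) * (1 / (1 + x ^ 2))) = K
  field_simp
  linear_combination -64 * hp

lemma arctanMoment_eq (m : ℕ) : arctanMoment m =
    ∑ i ∈ Finset.Icc 1 m, (-1 : ℝ) ^ (i + 1) *
      ((Real.pi + polygamma 0 ((2 * ((m : ℝ) - i + 1) + 1) / 4) -
        polygamma 0 ((2 * ((m : ℝ) - i + 1) + 3) / 4)) / (8 * ((m : ℝ) - i + 1))) +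
      (-1) ^ m * ((4 * catalanG - Real.pi * Real.log 2) / 8) := by
  rw [eq_alternating_sum arctanMoment_succ_add m, arctanMoment_zero]
  congr 1
  refine Finset.sum_congr rfl fun i hi => ?_
  rw [Nat.cast_sub (Finset.mem_Icc.1 hi).2]

lemma arctanLogMoment_eq (m : ℕ) : arctanLogMoment m =
    ∑ i ∈ Finset.Icc 1 m, (-1 : ℝ) ^ (i + 1) / (64 * ((m : ℝ) - i + 1) ^ 2) *
      (-4 * Real.pi + 4 * polygamma 0 ((2 * ((m : ℝ) - i + 1) + 3) / 4) -
        4 * polygamma 0 ((2 * ((m : ℝ) - i + 1) + 1) / 4) -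
        2 * ((m : ℝ) - i + 1) * (polygamma 1 ((2 * ((m : ℝ) - i + 1) + 3) / 4) -
          polygamma 1 ((2 * ((m : ℝ) - i + 1) + 1) / 4))) +
      (-1) ^ m / 96 * (3 * Real.pi ^ 3 + 6 * Real.pi * Real.log 2 ^ 2 - 192 * W3) := by
  rw [eq_alternating_sum arctanLogMoment_succ_add m, arctanLogMoment_zero]
  congr 1
  · refine Finset.sum_congr rfl fun i hi => ?_
    rw [Nat.cast_sub (Finset.mem_Icc.1 hi).2]
    ring
  · ring

/-- Integrating `x^(2m) log x arctan² x` by parts differentiates `arctan²` and brings back both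
first-power moments at the same index `m`. -/
lemma arctanSqLogMoment_succ_add (m : ℕ) :
    arctanSqLogMoment (m + 1) + arctanSqLogMoment m = 1 / (2 * (m : ℝ) + 1) *
      (-(Real.pi ^ 2 / 16) + m / (2 * (m : ℝ) + 1) * (Real.pi ^ 2 / 8 - 4 * arctanMoment m) -
        2 * arctanLogMoment m + 2 * arctanMoment m) := by
  have hg (x : ℝ) : HasDerivAt (fun x => Real.arctan x ^ 2)
      (2 * (Real.arctan x * (1 / (1 + x ^ 2)))) x :=
    ((Real.hasDerivAt_arctan x).fun_pow 2).congr_deriv (by simp; ring)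
  have hc := continuous_inv_one_add_sq
  have h := integral_log_mul_add (2 * m) (g := fun x => Real.arctan x ^ 2)
    (Real.continuous_arctan.pow 2)
  rw [integral_log_mul_pow_mul (2 * m) hg
    (continuous_const.mul (Real.continuous_arctan.mul hc)), Real.arctan_one] at h
  have e1 : ∫ x in 0..1, Real.log x * (x ^ (2 * m + 1) *
      (2 * (Real.arctan x * (1 / (1 + x ^ 2))))) = 2 * arctanLogMoment m := by
    rw [arctanLogMoment, ← intervalIntegral.integral_const_mul]
    exact intervalIntegral.integral_congr fun x _ => by ring
  have e2 : ∫ x in 0..1, x ^ (2 * m + 1) *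
      (2 * (Real.arctan x * (1 / (1 + x ^ 2)))) = 2 * arctanMoment m := by
    rw [arctanMoment, ← intervalIntegral.integral_const_mul]
    exact intervalIntegral.integral_congr fun x _ => by ring
  rw [e1, e2] at h
  rw [arctanSqLogMoment, arctanSqLogMoment, show 2 * (m + 1) = 2 * m + 2 by ring, h]
  have hm : 2 * (m : ℝ) + 1 ≠ 0 := by positivity
  push_cast
  field_simp
  ring

lemma arctanSqLogMoment_eq (k : ℕ) : arctanSqLogMoment k =
    ∑ j ∈ Finset.Icc 1 k, (-1 : ℝ) ^ (j + 1) / (2 * ((k - j : ℕ) : ℝ) + 1) *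
      (-(Real.pi ^ 2 / 16) + ((k - j : ℕ) : ℝ) / (2 * ((k - j : ℕ) : ℝ) + 1) *
        (Real.pi ^ 2 / 8 - 4 * arctanMoment (k - j)) -
        2 * arctanLogMoment (k - j) + 2 * arctanMoment (k - j)) +
      (-1) ^ k / 48 * (-3 * catalanG * Real.pi ^ 2 + 24 * dirichletBeta 4) := by
  rw [eq_alternating_sum arctanSqLogMoment_succ_add k, arctanSqLogMoment_zero]
  congr 1
  · exact Finset.sum_congr rfl fun j _ => by ring
  · ring

end ArctanLogSums

/-! ### The double series as an integral. -/

namespace ArctanLogSums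
open Set Filter Topology MeasureTheory

lemma oddHarmonic_eq_sum_range (n : ℕ) :
    oddHarmonic n = ∑ i ∈ Finset.range n, 1 / (2 * (i : ℝ) + 1) := by
  rw [oddHarmonic, Finset.range_eq_Ico]
  have := Finset.sum_Ico_add' (fun k : ℕ => 1 / (2 * (k : ℝ) - 1)) 0 n 1
  simp only [zero_add] at this
  rw [show Finset.Icc 1 n = Finset.Ico 1 (n + 1) from rfl, ← this]
  refine Finset.sum_congr rfl fun i _ => ?_
  push_cast
  ring_nf

lemma oddHarmonic_nonneg (n : ℕ) : 0 ≤ oddHarmonic n := by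
  rw [oddHarmonic_eq_sum_range]
  positivity

lemma oddHarmonic_le (n : ℕ) : oddHarmonic n ≤ 2 * √(n : ℝ) := by
  rw [oddHarmonic_eq_sum_range]
  induction n with
  | zero => simp
  | succ n ih =>
    rw [Finset.sum_range_succ]
    have ha : √(n : ℝ) ^ 2 = n := Real.sq_sqrt n.cast_nonneg
    have hb : √((n + 1 : ℕ) : ℝ) ^ 2 = n + 1 := by
      rw [Real.sq_sqrt (Nat.cast_nonneg _)]; push_cast; ring
    have hab : √(n : ℝ) ≤ √((n + 1 : ℕ) : ℝ) := Real.sqrt_le_sqrt (by simp)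
    have hb1 : 1 ≤ √((n + 1 : ℕ) : ℝ) := by rw [Real.one_le_sqrt]; simp
    have ha0 := Real.sqrt_nonneg (n : ℝ)
    -- With `a = √n` and `b = √(n+1)`, `(b - a)(b + a) = 1`, and `b + a` is at most `2(2n + 1)`.
    have hstep : 1 / (2 * (n : ℝ) + 1) ≤ 2 * (√((n + 1 : ℕ) : ℝ) - √(n : ℝ)) := by
      generalize √((n + 1 : ℕ) : ℝ) = b at *
      generalize √(n : ℝ) = a at *
      rw [div_le_iff₀ (by positivity)]
      have h1 : (b - a) * (b + a) = 1 := by nlinarith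
      have h2 : b + a ≤ 2 * (2 * (n : ℝ) + 1) := by nlinarith [sq_nonneg (a - 1)]
      calc 1 = (b - a) * (b + a) := h1.symm
        _ ≤ (b - a) * (2 * (2 * (n : ℝ) + 1)) := by gcongr
        _ = _ := by ring
    linarith

lemma abs_hTerm_le (k n j : ℕ) : |hTerm k (n + 1) j| ≤
    2 * (1 / ((n : ℝ) + 1) ^ (5 / 4 : ℝ)) * (1 / ((j : ℝ) + 1) ^ (5 / 4 : ℝ)) := by
  have hN : (0 : ℝ) < (n : ℝ) + 1 := by positivity
  have hJ : (0 : ℝ) < (j : ℝ) + 1 := by positivity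
  have hcast : ((n + 1 : ℕ) : ℝ) = (n : ℝ) + 1 := by push_cast; ring
  have hle := oddHarmonic_le (n + 1)
  rw [hcast] at hle
  rw [hTerm, abs_div, abs_mul, abs_pow, abs_neg, abs_one, one_pow, one_mul,
    abs_of_nonneg (oddHarmonic_nonneg _), hcast, abs_of_pos (by positivity)]
  set D : ℝ := 2 * (j : ℝ) + 2 * ((n : ℝ) + 1) + 2 * k + 1 with hD
  have hk : (0 : ℝ) ≤ k := k.cast_nonneg
  have hD1 : (n : ℝ) + 1 ≤ D := by rw [hD]; linarith [(j.cast_nonneg : (0 : ℝ) ≤ j)]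
  have hD2 : (j : ℝ) + 1 ≤ D := by rw [hD]; linarith [(j.cast_nonneg : (0 : ℝ) ≤ j)]
  have hD0 : 0 < D := hN.trans_le hD1
  -- The exponent 2 is split as `3/4 + 5/4`: with `h_n ≤ 2√n` and the factor `1/n`, the outer index
  -- also gets exponent `1 + 3/4 - 1/2 = 5/4 > 1`.
  have hsq : ((n : ℝ) + 1) ^ (3 / 4 : ℝ) * ((j : ℝ) + 1) ^ (5 / 4 : ℝ) ≤ D ^ 2 := by
    calc _ ≤ D ^ (3 / 4 : ℝ) * D ^ (5 / 4 : ℝ) := by gcongr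
      _ = D ^ 2 := by rw [← Real.rpow_add hD0, ← Real.rpow_natCast]; norm_num
  have hpow : ((n : ℝ) + 1) * ((n : ℝ) + 1) ^ (3 / 4 : ℝ) =
      ((n : ℝ) + 1) ^ (1 / 2 : ℝ) * ((n : ℝ) + 1) ^ (5 / 4 : ℝ) := by
    rw [← Real.rpow_add hN, ← Real.rpow_one_add' hN.le (by norm_num)]
    norm_num
  calc oddHarmonic (n + 1) / (((n : ℝ) + 1) * D ^ 2)
      ≤ 2 * √((n : ℝ) + 1) / (((n : ℝ) + 1) *
        (((n : ℝ) + 1) ^ (3 / 4 : ℝ) * ((j : ℝ) + 1) ^ (5 / 4 : ℝ))) := by gcongr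
    _ = _ := by
      rw [← mul_assoc ((n : ℝ) + 1), hpow, Real.sqrt_eq_rpow]
      field_simp

lemma summable_hTerm (k : ℕ) : Summable fun p : ℕ × ℕ => hTerm k (p.1 + 1) p.2 := by
  have h1 : Summable fun n : ℕ => 1 / ((n : ℝ) + 1) ^ (5 / 4 : ℝ) := by
    have := (summable_nat_add_iff 1).2
      (Real.summable_one_div_nat_rpow.2 (by norm_num : 1 < (5 / 4 : ℝ)))
    simpa using this
  refine .of_norm_bounded ((h1.mul_left 2).mul_of_nonneg h1 (fun n => by positivity)
    (fun n => by positivity)) fun p => abs_hTerm_le k p.1 p.2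

/-- Partial fractions: the two odd factors add up to `2(n + 1)`, so each product splits into a sum
of reciprocals. -/
lemma sum_antidiagonal_odd (n : ℕ) :
    ∑ p ∈ Finset.HasAntidiagonal.antidiagonal n, 1 / ((2 * (p.1 : ℝ) + 1) * (2 * (p.2 : ℝ) + 1)) =
      oddHarmonic (n + 1) / ((n : ℝ) + 1) := by
  have h1 : ∑ p ∈ Finset.HasAntidiagonal.antidiagonal n, 1 / (2 * (p.1 : ℝ) + 1) = oddHarmonic (n + 1) := by
    rw [oddHarmonic_eq_sum_range,
      Finset.Nat.sum_antidiagonal_eq_sum_range_succ_mk]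
  have h2 : ∑ p ∈ Finset.HasAntidiagonal.antidiagonal n, 1 / (2 * (p.2 : ℝ) + 1) = oddHarmonic (n + 1) := by
    rw [← h1, ← Finset.Nat.sum_antidiagonal_swap]
    rfl
  have h3 : oddHarmonic (n + 1) / ((n : ℝ) + 1) =
      (oddHarmonic (n + 1) + oddHarmonic (n + 1)) / (2 * ((n : ℝ) + 1)) := by
    field_simp; ring
  rw [h3]
  nth_rewrite 1 [← h1]
  rw [← h2, ← Finset.sum_add_distrib, Finset.sum_div]
  refine Finset.sum_congr rfl fun p hp => ?_
  have hn : (p.1 : ℝ) + p.2 = n := by exact_mod_cast Finset.HasAntidiagonal.mem_antidiagonal.1 hp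
  rw [← hn]
  have e1 : 2 * (p.1 : ℝ) + 1 ≠ 0 := by positivity
  have e2 : 2 * (p.2 : ℝ) + 1 ≠ 0 := by positivity
  have e3 : (p.1 : ℝ) + p.2 + 1 ≠ 0 := by positivity
  field_simp
  ring

lemma summable_norm_arctan_series {x : ℝ} (hx : ‖x‖ < 1) :
    Summable fun n : ℕ => ‖(-1 : ℝ) ^ n * x ^ (2 * n + 1) / ((2 * n + 1 : ℕ) : ℝ)‖ :=
  (Real.hasSum_arctan hx).summable.norm

lemma arctan_series_antidiagonal (x : ℝ) (n : ℕ) :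
    ∑ p ∈ Finset.HasAntidiagonal.antidiagonal n, (-1 : ℝ) ^ p.1 * x ^ (2 * p.1 + 1) / ((2 * p.1 + 1 : ℕ) : ℝ) *
      ((-1 : ℝ) ^ p.2 * x ^ (2 * p.2 + 1) / ((2 * p.2 + 1 : ℕ) : ℝ)) =
      (-1) ^ n * (oddHarmonic (n + 1) / ((n : ℝ) + 1)) * x ^ (2 * (n + 1)) := by
  rw [← sum_antidiagonal_odd, Finset.mul_sum, Finset.sum_mul]
  refine Finset.sum_congr rfl fun p hp => ?_
  rw [← Finset.HasAntidiagonal.mem_antidiagonal.1 hp]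
  push_cast
  field_simp
  ring

/-- The power series of `arctan²`. -/
lemma arctan_sq_eq_tsum {x : ℝ} (hx : ‖x‖ < 1) :
    (Summable fun n : ℕ =>
      ‖(-1) ^ n * (oddHarmonic (n + 1) / ((n : ℝ) + 1)) * x ^ (2 * (n + 1))‖) ∧
    ∑' n : ℕ, (-1) ^ n * (oddHarmonic (n + 1) / ((n : ℝ) + 1)) * x ^ (2 * (n + 1)) =
      Real.arctan x ^ 2 := by
  have hs := summable_norm_arctan_series hx
  have h1 := summable_norm_sum_mul_antidiagonal_of_summable_norm hs hs
  have h2 := tsum_mul_tsum_eq_tsum_sum_antidiagonal_of_summable_norm hs hs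
  simp only [arctan_series_antidiagonal] at h1 h2
  rw [(Real.hasSum_arctan hx).tsum_eq] at h2
  exact ⟨h1, by rw [← h2, sq]⟩

/-- Sum and integral are exchanged because the `L¹` norms of the terms are summable. -/
lemma hasSum_hTerm (k : ℕ) :
    HasSum (fun p : ℕ × ℕ => hTerm k (p.1 + 1) p.2) (arctanSqLogMoment k) := by
  set F : ℕ × ℕ → ℝ → ℝ := fun p x => Real.log x * (x ^ (2 * (p.2 + p.1 + 1 + k)) *
    ((-1) ^ (p.1 + p.2) * (oddHarmonic (p.1 + 1) / ((p.1 : ℝ) + 1)))) with hF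
  have hval (p : ℕ × ℕ) : ∫ x in Ioc 0 1, F p x = hTerm k (p.1 + 1) p.2 := by
    rw [← intervalIntegral.integral_of_le zero_le_one]
    simp only [hF, ← mul_assoc]
    simp only [mul_assoc _ ((-1 : ℝ) ^ _) _]
    rw [intervalIntegral.integral_mul_const, integral_log_mul_pow, hTerm]
    have : (p.1 : ℝ) + 1 ≠ 0 := by positivity
    have : 2 * ((p.2 : ℝ) + p.1 + 1 + k) + 1 ≠ 0 := by positivity
    have : 2 * (p.2 : ℝ) + 2 * (p.1 + 1) + 2 * k + 1 ≠ 0 := by positivity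
    push_cast
    rw [show p.1 + 1 + p.2 = p.1 + p.2 + 1 by ring, pow_succ (-1 : ℝ) (p.1 + p.2)]
    rw [show 2 * (p.2 : ℝ) + 2 * (p.1 + 1) + 2 * k + 1 = 2 * ((p.2 : ℝ) + p.1 + 1 + k) + 1 by ring]
    field_simp
  have hint (p : ℕ × ℕ) : IntegrableOn (F p) (Ioc 0 1) := by
    rw [← intervalIntegrable_iff_integrableOn_Ioc_of_le zero_le_one]
    exact intervalIntegral.intervalIntegrable_log'.mul_continuousOn (by fun_prop)
  -- Each term has constant sign on `(0, 1]`, so its `L¹` norm is the absolute value of its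
  -- integral.
  have hnorm (p : ℕ × ℕ) : ∫ x in Ioc 0 1, ‖F p x‖ = |hTerm k (p.1 + 1) p.2| := by
    have hsgn : ∀ x ∈ Ioc (0 : ℝ) 1, ‖F p x‖ = -(-1) ^ (p.1 + p.2) * F p x := fun x hx => by
      have h1 := Real.log_nonpos hx.1.le hx.2
      have h2 := oddHarmonic_nonneg (p.1 + 1)
      have h3 := hx.1
      simp only [hF]
      rw [norm_mul, norm_mul, norm_mul, norm_pow, norm_pow, norm_neg, norm_one, one_pow,
        Real.norm_of_nonpos h1, Real.norm_of_nonneg (div_nonneg h2 (by positivity)),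
        Real.norm_of_nonneg h3.le]
      have h4 : (-1 : ℝ) ^ (p.1 + p.2) * (-1) ^ (p.1 + p.2) = 1 := by
        rw [← mul_pow]; simp
      linear_combination (-Real.log x * x ^ (2 * (p.2 + p.1 + 1 + k)) *
        (oddHarmonic (p.1 + 1) / ((p.1 : ℝ) + 1))) * (-h4)
    have h0 : 0 ≤ ∫ x in Ioc 0 1, ‖F p x‖ := integral_nonneg fun x => norm_nonneg _
    rw [← abs_of_nonneg h0, setIntegral_congr_fun measurableSet_Ioc hsgn, integral_const_mul, hval,
      abs_mul, abs_neg, abs_pow, abs_neg, abs_one, one_pow, one_mul]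
  have h := hasSum_integral_of_summable_integral_norm hint
    (by simp only [hnorm]; exact (summable_hTerm k).abs)
  simp only [hval] at h
  convert! h using 1
  -- The endpoint 1 is discarded because the geometric series of `1 / (1 + x²)` does not converge
  -- there.
  rw [arctanSqLogMoment, intervalIntegral.integral_of_le zero_le_one, integral_Ioc_eq_integral_Ioo,
    integral_Ioc_eq_integral_Ioo]
  refine setIntegral_congr_fun measurableSet_Ioo fun x hx => ?_
  have hx1 : ‖x‖ < 1 := by rw [Real.norm_of_nonneg hx.1.le]; exact hx.2
  obtain ⟨s1, e1⟩ := arctan_sq_eq_tsum hx1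
  have hx2 : ‖-x ^ 2‖ < 1 := by
    rw [norm_neg, norm_pow]; exact pow_lt_one₀ (norm_nonneg _) hx1 two_ne_zero
  have s2 := (summable_geometric_of_norm_lt_one hx2).norm
  have e2 := tsum_geometric_of_norm_lt_one hx2
  rw [← e1, one_div, show 1 + x ^ 2 = 1 - -x ^ 2 by ring, ← e2,
    tsum_mul_tsum_of_summable_norm s1 s2, ← tsum_mul_left, ← tsum_mul_left]
  refine tsum_congr fun p => ?_
  simp only [hF]
  rw [neg_pow (x ^ 2), pow_add (-1 : ℝ), ← pow_mul]
  ring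

lemma milgram_one (n : ℕ) : milgram 1 n = 2 * oddHarmonic (n + 1) := by
  rw [oddHarmonic_eq_sum_range, Finset.mul_sum, milgram]
  refine Finset.sum_congr rfl fun m _ => ?_
  simp only [milgram]
  have : 2 * (m : ℝ) + 1 ≠ 0 := by positivity
  have : (m : ℝ) + 1 / 2 ≠ 0 := by positivity
  push_cast
  field_simp
  ring

lemma tTerm_eq_hTerm (k n j : ℕ) : tTerm k n j = hTerm k (n + 1) j := by
  rw [tTerm, hTerm, milgram_one, show n + 1 + j = n + j + 1 by ring]
  push_cast
  rw [show 2 * (j : ℝ) + 2 * (n + 1) + 2 * k + 1 = 2 * n + 2 * j + 2 * k + 3 by ring]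
  have : (n : ℝ) + 1 ≠ 0 := by positivity
  have : 2 * (n : ℝ) + 2 * j + 2 * k + 3 ≠ 0 := by positivity
  field_simp

end ArctanLogSums

/-! ### Assembly of the closed form. -/

theorem theorem3p4 (k : ℕ) :
    -- both double series converge absolutely
    Summable (fun p : ℕ × ℕ => hTerm k (p.1 + 1) p.2) ∧
    Summable (fun p : ℕ × ℕ => tTerm k p.1 p.2) ∧
    -- the two double sums agree (the first one runs over `n + 1 ≥ 1`)
    ∑' n : ℕ, ∑' j : ℕ, hTerm k (n + 1) j = ∑' n : ℕ, ∑' j : ℕ, tTerm k n j ∧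
    -- and their common value is
    ∑' n : ℕ, ∑' j : ℕ, hTerm k (n + 1) j =
      (∑ j ∈ Finset.Icc 1 k, (-1 : ℝ) ^ (j + 1) / (2 * (k : ℝ) - 2 * j + 1) *
        (-(Real.pi ^ 2 / 16)
          + ((k : ℝ) - j) / (2 * (k : ℝ) - 2 * j + 1) *
            (Real.pi ^ 2 / 8 - (-1 : ℝ) ^ (k - j) * 2 * catalanG
              + (-1 : ℝ) ^ (k - j) / 2 * Real.pi * Real.log 2
              - ∑ i ∈ Finset.Icc 1 (k - j), (-1 : ℝ) ^ (i + 1) *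
                  ((Real.pi + harmonicNumber ((2 * (k : ℝ) - 2 * j - 2 * i - 1) / 4)
                      - harmonicNumber ((2 * (k : ℝ) - 2 * j - 2 * i + 1) / 4))
                    / (2 * (k : ℝ) + 2 - 2 * j - 2 * i)))
          - 2 * ((∑ i ∈ Finset.Icc 1 (k - j),
                  (-1 : ℝ) ^ (i + 1) / (64 * ((k : ℝ) + 1 - j - i) ^ 2) *
                  (-4 * Real.pi
                    + 4 * polygamma 0 ((2 * (k : ℝ) + 5 - 2 * j - 2 * i) / 4)
                    - 4 * polygamma 0 ((2 * (k : ℝ) + 3 - 2 * j - 2 * i) / 4)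
                    - 2 * ((k : ℝ) + 1 - j - i) *
                      (polygamma 1 ((2 * (k : ℝ) + 5 - 2 * j - 2 * i) / 4)
                        - polygamma 1 ((2 * (k : ℝ) + 3 - 2 * j - 2 * i) / 4))))
              + (-1 : ℝ) ^ (k - j) / 96 *
                  (3 * Real.pi ^ 3 + 6 * Real.pi * Real.log 2 ^ 2 - 192 * W3))
          + 2 * ((∑ i ∈ Finset.Icc 1 (k - j), (-1 : ℝ) ^ (i + 1) *
                  ((Real.pi + harmonicNumber ((2 * (k : ℝ) - 1 - 2 * j - 2 * i) / 4)
                      - harmonicNumber ((2 * (k : ℝ) + 1 - 2 * j - 2 * i) / 4))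
                    / (8 * ((k : ℝ) + 1 - j - i))))
              + (-1 : ℝ) ^ (k - j) * ((4 * catalanG - Real.pi * Real.log 2) / 8))))
      + (-1 : ℝ) ^ k / 48 * (-3 * catalanG * Real.pi ^ 2 + 24 * dirichletBeta 4) := by
  have hs := hasSum_hTerm k
  have htsum : ∑' n : ℕ, ∑' j : ℕ, hTerm k (n + 1) j = arctanSqLogMoment k := by
    rw [← hs.tsum_eq, hs.summable.tsum_prod]
  refine ⟨hs.summable, ?_, ?_, ?_⟩
  · simpa only [tTerm_eq_hTerm] using hs.summable
  · simp only [tTerm_eq_hTerm]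
  · rw [htsum, arctanSqLogMoment_eq]
    congr 1
    refine Finset.sum_congr rfl fun j hj => ?_
    -- Writing `k = j + m` removes the truncated subtraction `k - j`.
    obtain ⟨m, rfl⟩ := Nat.exists_eq_add_of_le (Finset.mem_Icc.1 hj).2
    rw [Nat.add_sub_cancel_left]
    have e1 : ∑ i ∈ Finset.Icc 1 m, (-1 : ℝ) ^ (i + 1) *
        ((Real.pi + harmonicNumber ((2 * ((j + m : ℕ) : ℝ) - 1 - 2 * j - 2 * i) / 4)
          - harmonicNumber ((2 * ((j + m : ℕ) : ℝ) + 1 - 2 * j - 2 * i) / 4))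
            / (8 * (((j + m : ℕ) : ℝ) + 1 - j - i))) + (-1 : ℝ) ^ m *
              ((4 * catalanG - Real.pi * Real.log 2) / 8) = arctanMoment m := by
      rw [arctanMoment_eq]
      congr 1
      refine Finset.sum_congr rfl fun i _ => ?_
      simp only [harmonicNumber]
      push_cast
      ring_nf
    -- This sum has denominators four times smaller than those in `arctanMoment`, so the parenthesis
    -- in the statement is `π²/8 - 4 · arctanMoment m`. Euler's constant cancels in each difference
    -- of harmonic numbers.
    have e2 : ∑ i ∈ Finset.Icc 1 m, (-1 : ℝ) ^ (i + 1) *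
        ((Real.pi + harmonicNumber ((2 * ((j + m : ℕ) : ℝ) - 2 * j - 2 * i - 1) / 4)
          - harmonicNumber ((2 * ((j + m : ℕ) : ℝ) - 2 * j - 2 * i + 1) / 4))
            / (2 * ((j + m : ℕ) : ℝ) + 2 - 2 * j - 2 * i)) = 4 * (arctanMoment m - (-1 : ℝ) ^ m *
              ((4 * catalanG - Real.pi * Real.log 2) / 8)) := by
      rw [arctanMoment_eq, add_sub_cancel_right, Finset.mul_sum]
      refine Finset.sum_congr rfl fun i hi => ?_
      have hi' : (i : ℝ) ≤ m := by exact_mod_cast (Finset.mem_Icc.1 hi).2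
      have h0 : (m : ℝ) - i + 1 ≠ 0 := by linarith
      simp only [harmonicNumber]
      push_cast
      rw [show (2 * ((j : ℝ) + m) - 2 * j - 2 * i - 1) / 4 + 1 = (2 * ((m : ℝ) - i + 1) + 1) / 4 by
          ring,
        show (2 * ((j : ℝ) + m) - 2 * j - 2 * i + 1) / 4 + 1 = (2 * ((m : ℝ) - i + 1) + 3) / 4 by
          ring,
        show 2 * ((j : ℝ) + m) + 2 - 2 * j - 2 * i = 2 * ((m : ℝ) - i + 1) by ring]
      field_simp
      ring
    have e3 : ∑ i ∈ Finset.Icc 1 m,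
        (-1 : ℝ) ^ (i + 1) / (64 * (((j + m : ℕ) : ℝ) + 1 - j - i) ^ 2) *
          (-4 * Real.pi + 4 * polygamma 0 ((2 * ((j + m : ℕ) : ℝ) + 5 - 2 * j - 2 * i) / 4)
            - 4 * polygamma 0 ((2 * ((j + m : ℕ) : ℝ) + 3 - 2 * j - 2 * i) / 4)
            - 2 * (((j + m : ℕ) : ℝ) + 1 - j - i) *
              (polygamma 1 ((2 * ((j + m : ℕ) : ℝ) + 5 - 2 * j - 2 * i) / 4)
                - polygamma 1 ((2 * ((j + m : ℕ) : ℝ) + 3 - 2 * j - 2 * i) / 4))) +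
        (-1 : ℝ) ^ m / 96 * (3 * Real.pi ^ 3 + 6 * Real.pi * Real.log 2 ^ 2 - 192 * W3) =
        arctanLogMoment m := by
      rw [arctanLogMoment_eq]
      congr 1
      refine Finset.sum_congr rfl fun i _ => ?_
      push_cast
      rw [show (2 * ((j : ℝ) + m) + 5 - 2 * j - 2 * i) / 4 = (2 * ((m : ℝ) - i + 1) + 3) / 4 by
          ring,
        show (2 * ((j : ℝ) + m) + 3 - 2 * j - 2 * i) / 4 = (2 * ((m : ℝ) - i + 1) + 1) / 4 by
          ring,
        show (j : ℝ) + m + 1 - j - i = (m : ℝ) - i + 1 by ring]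
    rw [e1, e2, e3]
    have e4 : 2 * ((j + m : ℕ) : ℝ) - 2 * j + 1 = 2 * (m : ℝ) + 1 := by push_cast; ring
    have e5 : ((j + m : ℕ) : ℝ) - j = m := by push_cast; ring
    rw [e4, e5]
    ring
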